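/- Let $F$ be a finite-dimensional real vector space with a non-degenerate symmetric bilinear form $\langle\,,\,\rangle$, and assume $\dim_{\mathbb R}F=2r$. Let $C^{-\xi}(F)$ be the space of (complex) tempered generalized functions on $F$, i.e. of continuous linear functionals on the Schwartz densities on $F$, and let $W[F]$ be the Weyl algebra of complex polynomial coefficient differential operators on $F$, acting on $C^{-\xi}(F)$ in the natural way. Let $dy$ be the Lebesgue measure on $F$ for which the cube spanned by any orthogonal basis $v_1,\dots,v_{2r}$ with $\langle v_i,v_i\rangle=\pm1$ has volume $1$, and let $\mathcal F$ be the Fourier transform $(\mathcal F f)(x)=\int_F f(y)e^{-2\pi\sqrt{-1}\langle x,y\rangle}\,dy$ on Schwartz functions, extended continuously to $C^{-\xi}(F)$. For unions $Z_1,Z_2$ of finitely many linear subspaces of $F$, let $C^{-\xi}(F;Z_1,Z_2)$ be the $W[F]$-submodule of all $f\in C^{-\xi}(F)$ such that $f$ is supported in $Z_1$ and $\mathcal F f$ is supported in $Z_2$. Let $F_1,\dots,F_s$ be distinct totally isotropic subspaces of $F$, each of dimension $r$. Then the $W[F]$-module $$C^{-\xi}(F;\,F_1\cup\dots\cup F_s,\,F_1\cup\dots\cup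 F_s)$$ is completely reducible and of finite length, and each of its irreducible factors (that is, each simple subquotient) is isomorphic, as a $W[F]$-module, to $C^{-\xi}(F;F_i,F_i)$ for some $i\in\{1,\dots,s\}$. -/

import Mathlib

open scoped SchwartzMap LineDeriv

set_option linter.unusedSectionVars false

noncomputable section

namespace QuadSpace

open MeasureTheory Module FourierTransform LineDeriv

variable {F : Type*} [NormedAddCommGroup F] [NormedSpace ℝ F] [FiniteDimensional ℝ F]

/-! ### The Lebesgue measure of a quadratic space -/

section Measure

variable [MeasurableSpace F] [BorelSpace F]

/-- The Lebesgue measure on `F` normalized by the non-degenerate form `B`: the Lebesgue measure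
`dy` of an auxiliary basis, rescaled by `|det (Gram matrix of B)|^{1/2}`. It gives volume `1` to
the cube spanned by any orthogonal basis `v` with `B (v i) (v i) = ± 1`, see
`volumeOf_parallelepiped`. -/
def volumeOf (B : LinearMap.BilinForm ℝ F) : Measure F :=
  ENNReal.ofReal (Real.sqrt |(LinearMap.BilinForm.toMatrix (finBasis ℝ F) B).det|) •
    (finBasis ℝ F).addHaar

/-- The normalization of `volumeOf B`. -/
theorem volumeOf_parallelepiped (B : LinearMap.BilinForm ℝ F)
    (v : Basis (Fin (finrank ℝ F)) ℝ F) (hv : ∀ i j, i ≠ j → B (v i) (v j) = 0)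
    (hv' : ∀ i, B (v i) (v i) = 1 ∨ B (v i) (v i) = -1) :
    volumeOf B (parallelepiped v) = 1 := by
  have h := LinearMap.BilinForm.toMatrix_mul_basis_toMatrix (b := finBasis ℝ F) v B
  have hdiag : LinearMap.BilinForm.toMatrix v B = Matrix.diagonal fun i => B (v i) (v i) := by
    ext i j
    by_cases hij : i = j
    · subst hij; simp
    · simp [hij, hv i j hij]
  have hdet := congrArg (fun M => |Matrix.det M|) h
  simp only [Matrix.det_mul, Matrix.det_transpose, hdiag, Matrix.det_diagonal, abs_mul,
    Finset.abs_prod] at hdet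
  have h1 : ∀ i, |B (v i) (v i)| = 1 := fun i => by rcases hv' i with h | h <;> simp [h]
  simp only [h1, Finset.prod_const_one, ← Basis.det_apply] at hdet
  simp only [volumeOf, Measure.smul_apply, Measure.addHaar_parallelepiped, smul_eq_mul]
  rw [← ENNReal.ofReal_mul (Real.sqrt_nonneg _), ← Real.sqrt_sq (abs_nonneg ((finBasis ℝ F).det v)),
    ← Real.sqrt_mul (abs_nonneg _)]
  rw [show |(LinearMap.BilinForm.toMatrix (finBasis ℝ F) B).det| * |(finBasis ℝ F).det v| ^ 2 = 1 by
    rw [← hdet]; ring]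
  simp

end Measure

/-! ### The Fourier transform of a quadratic space -/

section Fourier

/-- Linear identification of `F` with the standard Euclidean space, along an auxiliary basis. -/
def toEuclid (F : Type*) [NormedAddCommGroup F] [NormedSpace ℝ F]
    [FiniteDimensional ℝ F] : F ≃L[ℝ] EuclideanSpace ℝ (Fin (finrank ℝ F)) :=
  ((finBasis ℝ F).equiv (EuclideanSpace.basisFun (Fin (finrank ℝ F)) ℝ).toBasis
    (Equiv.refl _)).toContinuousLinearEquiv

theorem exists_adj (B : LinearMap.BilinForm ℝ F) (hB : B.Nondegenerate) :
    ∃ A : F ≃L[ℝ] EuclideanSpace ℝ (Fin (finrank ℝ F)),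
      ∀ x y, inner ℝ (toEuclid F y) (A x) = B x y := by
  let A₀ : F →ₗ[ℝ] EuclideanSpace ℝ (Fin (finrank ℝ F)) :=
    { toFun := fun x => (InnerProductSpace.toDual ℝ _).symm
        (LinearMap.toContinuousLinearMap ((B x) ∘ₗ ((toEuclid F).symm.toLinearEquiv : _ →ₗ[ℝ] F)))
      map_add' := fun x y => by
        rw [← map_add]; congr 1; ext; simp
      map_smul' := fun c x => by
        apply ext_inner_right ℝ; intro z
        simp [InnerProductSpace.toDual_symm_apply, inner_smul_left] }
  have hA₀ : ∀ x y, inner ℝ (toEuclid F y) (A₀ x) = B x y := fun x y => by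
    rw [real_inner_comm]
    simp [A₀, InnerProductSpace.toDual_symm_apply]
  have hinj : Function.Injective A₀ := by
    rw [injective_iff_map_eq_zero]
    intro x hx
    refine hB.1 x fun y => ?_
    rw [← hA₀, hx, inner_zero_right]
  exact ⟨(LinearEquiv.ofInjectiveOfFinrankEq A₀ hinj (by simp)).toContinuousLinearEquiv,
    fun x y => hA₀ x y⟩

theorem lineDeriv_comp_equiv {D E : Type*} [NormedAddCommGroup D] [NormedSpace ℝ D]
    [NormedAddCommGroup E] [NormedSpace ℝ E] (g : D ≃L[ℝ] E) (f : 𝓢(E, ℂ)) (m : D) :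
    ∂_{m} (SchwartzMap.compCLMOfContinuousLinearEquiv ℂ g f) =
      SchwartzMap.compCLMOfContinuousLinearEquiv ℂ g (∂_{g m} f) := by
  ext x
  simp [SchwartzMap.lineDerivOp_apply_eq_fderiv, ContinuousLinearEquiv.comp_right_fderiv]

variable [MeasurableSpace F] [BorelSpace F]

theorem exists_fourier (B : LinearMap.BilinForm ℝ F) (hB : B.Nondegenerate) :
    ∃ T : 𝓢(F, ℂ) →L[ℂ] 𝓢(F, ℂ),
      (∀ (φ : 𝓢(F, ℂ)) (x : F), T φ x =
        ∫ y, φ y * Complex.exp (-(2 * Real.pi * Complex.I * B x y)) ∂(volumeOf B)) ∧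
      (∀ (φ : 𝓢(F, ℂ)) (m : F), ∂_{m} (T φ) =
        T (-(2 * Real.pi * Complex.I) • SchwartzMap.smulLeftCLM ℂ (fun y => (B m y : ℂ)) φ)) ∧
      (∀ (φ : 𝓢(F, ℂ)) (m : F), T (∂_{m} φ) =
        (2 * Real.pi * Complex.I) • SchwartzMap.smulLeftCLM ℂ (fun x => (B x m : ℂ)) (T φ)) := by
  obtain ⟨A, hA⟩ := exists_adj B hB
  set c : ℝ := Real.sqrt |(LinearMap.BilinForm.toMatrix (finBasis ℝ F) B).det| with hc
  have hvol : (volume : Measure (EuclideanSpace ℝ (Fin (finrank ℝ F)))) =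
      (finBasis ℝ F).addHaar.map (toEuclid F) := by
    rw [Basis.map_addHaar, ← (EuclideanSpace.basisFun (Fin (finrank ℝ F)) ℝ).addHaar_eq_volume]
    congr 1
    ext1 i
    simp [toEuclid]
  let pre : 𝓢(F, ℂ) →L[ℂ] 𝓢(EuclideanSpace ℝ (Fin (finrank ℝ F)), ℂ) :=
    SchwartzMap.compCLMOfContinuousLinearEquiv ℂ (toEuclid F).symm
  let post : 𝓢(EuclideanSpace ℝ (Fin (finrank ℝ F)), ℂ) →L[ℂ] 𝓢(F, ℂ) :=
    SchwartzMap.compCLMOfContinuousLinearEquiv ℂ A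
  have htg : ∀ m, (fun y => (B m y : ℂ)).HasTemperateGrowth := fun m =>
    (Complex.ofRealCLM ∘L LinearMap.toContinuousLinearMap (B m)).hasTemperateGrowth
  have htg' : ∀ m, (fun y => (B y m : ℂ)).HasTemperateGrowth := fun m =>
    (Complex.ofRealCLM ∘L LinearMap.toContinuousLinearMap (B.flip m)).hasTemperateGrowth
  have hin : ∀ m : EuclideanSpace ℝ (Fin (finrank ℝ F)),
      (inner ℝ · m : EuclideanSpace ℝ (Fin (finrank ℝ F)) → ℝ).HasTemperateGrowth := fun m =>
    ((innerSL ℝ).flip m).hasTemperateGrowth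
  refine ⟨(c : ℂ) • (post ∘L (fourierCLM ℂ 𝓢(EuclideanSpace ℝ (Fin (finrank ℝ F)), ℂ)) ∘L pre),
    fun φ x => ?_, fun φ m => ?_, fun φ m => ?_⟩
  · have h0 : volumeOf B = ENNReal.ofReal c • (finBasis ℝ F).addHaar := rfl
    rw [h0, integral_smul_measure, ENNReal.toReal_ofReal (Real.sqrt_nonneg _)]
    simp only [smul_apply, ContinuousLinearMap.comp_apply, smul_eq_mul, Complex.real_smul, post, SchwartzMap.compCLMOfContinuousLinearEquiv_apply,
      Function.comp_apply, fourierCLM_apply, SchwartzMap.fourier_coe, Real.fourier_eq', pre]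
    congr 1
    rw [hvol]
    refine ((toEuclid F).toHomeomorph.measurableEmbedding.integral_map _).trans ?_
    congr 1
    ext y
    simp only [ContinuousLinearEquiv.coe_toHomeomorph, hA, ContinuousLinearEquiv.symm_apply_apply]
    rw [mul_comm]
    congr 2
    push_cast
    ring
  · have h1 : pre (SchwartzMap.smulLeftCLM ℂ (fun y => (B m y : ℂ)) φ) =
        SchwartzMap.smulLeftCLM ℂ (inner ℝ · (A m)) (pre φ) := by
      ext z
      have := hA m ((toEuclid F).symm z)
      rw [ContinuousLinearEquiv.apply_symm_apply] at this
      simp [pre, SchwartzMap.smulLeftCLM_apply_apply (htg m),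
        SchwartzMap.smulLeftCLM_apply_apply (hin _), this]
    simp only [smul_apply, ContinuousLinearMap.comp_apply, map_smul, h1]
    rw [lineDerivOp_smul, lineDeriv_comp_equiv, fourierCLM_apply, SchwartzMap.lineDerivOp_fourier_eq]
    simp only [fourierCLM_apply, fourier_smul, map_smul, post]
    rw [smul_comm]
  · have h1 : pre (∂_{m} φ) = ∂_{toEuclid F m} (pre φ) := by
      ext z
      simp [pre, SchwartzMap.lineDerivOp_apply_eq_fderiv, ContinuousLinearEquiv.comp_right_fderiv]
    have h2 : ∀ g, post (SchwartzMap.smulLeftCLM ℂ (inner ℝ · (toEuclid F m)) g) =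
        SchwartzMap.smulLeftCLM ℂ (fun x => (B x m : ℂ)) (post g) := by
      intro g
      ext z
      simp [post, SchwartzMap.smulLeftCLM_apply_apply (htg' m),
        SchwartzMap.smulLeftCLM_apply_apply (hin _), ← hA z m, real_inner_comm]
    simp only [smul_apply, ContinuousLinearMap.comp_apply, map_smul, h1]
    rw [fourierCLM_apply, SchwartzMap.fourier_lineDerivOp_eq]
    simp only [fourierCLM_apply, map_smul, h2]
    rw [smul_comm]

/-- The Fourier transform of Schwartz functions on the quadratic space `(F, B)`: the continuous
linear map `𝓢(F) → 𝓢(F)`, `φ ↦ (x ↦ ∫ φ(y) e^{-2πi B(x,y)} dy)`, with `dy = volumeOf B`. The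
formula is `fourierS_apply`, and determines the map. -/
def fourierS (B : LinearMap.BilinForm ℝ F) (hB : B.Nondegenerate) : 𝓢(F, ℂ) →L[ℂ] 𝓢(F, ℂ) :=
  (exists_fourier B hB).choose

theorem fourierS_apply (B : LinearMap.BilinForm ℝ F) (hB : B.Nondegenerate) (φ : 𝓢(F, ℂ))
    (x : F) : fourierS B hB φ x =
      ∫ y, φ y * Complex.exp (-(2 * Real.pi * Complex.I * B x y)) ∂(volumeOf B) :=
  (exists_fourier B hB).choose_spec.1 φ x

theorem integral_fourierS_mul (B : LinearMap.BilinForm ℝ F) (hB : B.Nondegenerate)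
    (hs : B.IsSymm) (g φ : 𝓢(F, ℂ)) :
    ∫ x, fourierS B hB g x * φ x ∂(volumeOf B) = ∫ x, g x * fourierS B hB φ x ∂(volumeOf B) := by
  have hF : ∀ (h : 𝓢(F, ℂ)) (x : F), fourierS B hB h x =
      VectorFourier.fourierIntegral Real.fourierChar (volumeOf B) B h x := by
    intro h x
    rw [fourierS_apply, VectorFourier.fourierIntegral]
    congr 1
    ext y
    rw [Circle.smul_def, Real.fourierChar_apply, smul_eq_mul, mul_comm, hs.eq y x]
    congr 2
    push_cast
    ring
  have hi : ∀ h : 𝓢(F, ℂ), Integrable h (volumeOf B) := fun h =>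
    (h.integrable (μ := (finBasis ℝ F).addHaar)).smul_measure ENNReal.ofReal_ne_top
  have hfin : SigmaFinite (volumeOf B) := 
    inferInstanceAs (SigmaFinite (Real.toNNReal (Real.sqrt
      |(LinearMap.BilinForm.toMatrix (finBasis ℝ F) B).det|) • (finBasis ℝ F).addHaar))
  have hc : Continuous fun p : F × F => B p.1 p.2 := by
    have : (fun p : F × F => B p.1 p.2) =
        fun p => LinearMap.toContinuousBilinearMap B p.1 p.2 := rfl
    rw [this]; fun_prop
  have key := VectorFourier.integral_fourierIntegral_smul_eq_flip (L := B)
    (μ := volumeOf B) (ν := volumeOf B) Real.continuous_fourierChar hc (hi g) (hi φ)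
  have hflip : LinearMap.flip B = B := by ext x y; exact hs.eq y x
  simp only [hF]
  rw [hflip] at key
  simpa only [smul_eq_mul] using key

/-- The Fourier transform of tempered generalized functions on the quadratic space `(F, B)`, for
symmetric `B`. A tempered generalized function is a continuous linear functional on Schwartz
densities `φ dy`, that is, with `dy = volumeOf B` fixed, on Schwartz functions `φ`; since
`∫ (𝓕 g) φ dy = ∫ g (𝓕 φ) dy` for Schwartz `g`, `φ` (`integral_fourierS_mul`), the continuous extension of the Fourier
transform is the transpose of `fourierS`. -/
def fourierD (B : LinearMap.BilinForm ℝ F) (hB : B.Nondegenerate) : 𝓢'(F, ℂ) →L[ℂ] 𝓢'(F, ℂ) :=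
  PointwiseConvergenceCLM.precomp ℂ (fourierS B hB)

theorem fourierD_apply (B : LinearMap.BilinForm ℝ F) (hB : B.Nondegenerate) (f : 𝓢'(F, ℂ))
    (φ : 𝓢(F, ℂ)) : fourierD B hB f φ = f (fourierS B hB φ) := rfl

theorem fourierD_lineDeriv (B : LinearMap.BilinForm ℝ F) (hB : B.Nondegenerate) (f : 𝓢'(F, ℂ))
    (m : F) : fourierD B hB (∂_{m} f) = (2 * Real.pi * Complex.I) •
      TemperedDistribution.smulLeftCLM ℂ (fun y => (B m y : ℂ)) (fourierD B hB f) := by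
  ext φ
  have h := (exists_fourier B hB).choose_spec.2.1 φ m
  change f (-(∂_{m} (fourierS B hB φ))) = (2 * Real.pi * Complex.I) •
    f (fourierS B hB (SchwartzMap.smulLeftCLM ℂ (fun y => (B m y : ℂ)) φ))
  rw [fourierS, h]
  simp

theorem fourierD_smul (B : LinearMap.BilinForm ℝ F) (hB : B.Nondegenerate) (f : 𝓢'(F, ℂ))
    (m : F) : (2 * Real.pi * Complex.I) • fourierD B hB
      (TemperedDistribution.smulLeftCLM ℂ (fun y => (B y m : ℂ)) f) =
        -(∂_{m} (fourierD B hB f)) := by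
  ext φ
  have h := (exists_fourier B hB).choose_spec.2.2 φ m
  change (2 * Real.pi * Complex.I) •
    f (SchwartzMap.smulLeftCLM ℂ (fun y => (B y m : ℂ)) (fourierS B hB φ)) =
      -(f (fourierS B hB (-(∂_{m} φ))))
  rw [map_neg, map_neg, neg_neg, fourierS, h]
  simp

end Fourier

/-! ### The Weyl algebra and its modules of generalized functions -/

section Weyl

/-- Multiplication of tempered generalized functions by a real linear functional. -/
def mulOp (l : F →L[ℝ] ℝ) : End ℂ 𝓢'(F, ℂ) :=
  (TemperedDistribution.smulLeftCLM ℂ (fun x : F => (l x : ℂ))).toLinearMap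

/-- The partial derivative `∂v` of tempered generalized functions along the vector `v`. -/
def derivOp (v : F) : End ℂ 𝓢'(F, ℂ) :=
  (lineDerivOpCLM ℂ 𝓢'(F, ℂ) v).toLinearMap

variable (F) in
/-- The algebra of complex polynomial coefficient differential operators, acting on tempered
generalized functions on `F`: the complex algebra of operators generated by the multiplications by
linear functionals (which generate all polynomial functions) and by the partial derivatives. -/
def weylOps : Subalgebra ℂ (End ℂ 𝓢'(F, ℂ)) :=
  Algebra.adjoin ℂ (Set.range mulOp ∪ Set.range derivOp)

variable (F) in
/-- The Weyl algebra `W[F]` of complex polynomial coefficient differential operators on `F`,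
realized through its (faithful) natural action on tempered generalized functions. -/
def Weyl : Type _ := weylOps F

instance : Ring (Weyl F) := inferInstanceAs (Ring (weylOps F))

instance : Algebra ℂ (Weyl F) := inferInstanceAs (Algebra ℂ (weylOps F))

/-- The natural module structure: an operator acts on generalized functions by evaluation. -/
instance : Module (Weyl F) 𝓢'(F, ℂ) := inferInstanceAs (Module (weylOps F) 𝓢'(F, ℂ))

theorem weyl_smul_def (D : weylOps F) (f : 𝓢'(F, ℂ)) :
    (show Weyl F from D) • f = (D : End ℂ 𝓢'(F, ℂ)) f := rfl

theorem hasTemperateGrowth_ofReal (l : F →L[ℝ] ℝ) :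
    (fun x : F => (l x : ℂ)).HasTemperateGrowth :=
  (Complex.ofRealCLM ∘L l).hasTemperateGrowth

open Distribution in
theorem dsupport_add_subset {f g : 𝓢'(F, ℂ)} {Z : Set F} (hf : dsupport f ⊆ Z)
    (hg : dsupport g ⊆ Z) : dsupport (f + g) ⊆ Z := by
  intro x hx
  by_contra hxZ
  obtain ⟨s, hs, hso, hxs⟩ := (notMem_dsupport_iff x).1 fun h => hxZ (hf h)
  obtain ⟨t, ht, hto, hxt⟩ := (notMem_dsupport_iff x).1 fun h => hxZ (hg h)
  refine (notMem_dsupport_iff x).2 ⟨s ∩ t, fun φ hφ => ?_, hso.inter hto, hxs, hxt⟩ hx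
  have h1 := hs φ (hφ.trans Set.inter_subset_left)
  have h2 := ht φ (hφ.trans Set.inter_subset_right)
  change f φ + g φ = 0
  rw [h1, h2, add_zero]

open Distribution in
theorem dsupport_smul_subset {f : 𝓢'(F, ℂ)} {Z : Set F} (hf : dsupport f ⊆ Z) (c : ℂ) :
    dsupport (c • f) ⊆ Z := by
  refine (dsupport_subset_dsupport fun s _ hs φ hφ => ?_).trans hf
  change c • f φ = 0
  rw [hs φ hφ, smul_zero]

open Distribution in
theorem dsupport_zero_subset (Z : Set F) : dsupport (0 : 𝓢'(F, ℂ)) ⊆ Z := by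
  intro x hx
  exact absurd hx ((notMem_dsupport_iff x).2 ⟨Set.univ, fun φ _ => rfl, isOpen_univ, trivial⟩)

variable [MeasurableSpace F] [BorelSpace F]

open Distribution in
theorem supported_weyl (B : LinearMap.BilinForm ℝ F) (hB : B.Nondegenerate) (Z₁ Z₂ : Set F)
    {D : End ℂ 𝓢'(F, ℂ)} (hD : D ∈ weylOps F) : ∀ f : 𝓢'(F, ℂ),
      dsupport f ⊆ Z₁ ∧ dsupport (fourierD B hB f) ⊆ Z₂ →
        dsupport (D f) ⊆ Z₁ ∧ dsupport (fourierD B hB (D f)) ⊆ Z₂ := by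
  have hpi : (2 * Real.pi * Complex.I : ℂ) ≠ 0 := Complex.two_pi_I_ne_zero
  induction hD using Algebra.adjoin_induction with
  | mem D hD =>
    rintro f ⟨h1, h2⟩
    rcases hD with ⟨l, rfl⟩ | ⟨v, rfl⟩
    · refine ⟨(TemperedDistribution.dsupport_smulLeftCLM_subset
        (hasTemperateGrowth_ofReal l)).trans h1, ?_⟩
      obtain ⟨m, hm⟩ := (B.flip.toDual hB.flip).surjective (l : F →ₗ[ℝ] ℝ)
      have hl : mulOp l f = TemperedDistribution.smulLeftCLM ℂ (fun y => (B y m : ℂ)) f := by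
        have : ∀ y, l y = B y m := fun y => by
          have := congrArg (fun k => k y) hm
          rw [LinearMap.BilinForm.toDual_def] at this
          exact this.symm
        simp only [mulOp, this]
        rfl
      have h3 : fourierD B hB (mulOp l f) = (2 * Real.pi * Complex.I : ℂ)⁻¹ •
          ((-1 : ℂ) • (∂_{m} (fourierD B hB f))) := by
        have h4 : (-1 : ℂ) • (∂_{m} (fourierD B hB f)) = -(∂_{m} (fourierD B hB f)) := by
          ext φ
          exact neg_one_smul ℂ _
        rw [hl, h4, ← fourierD_smul, inv_smul_smul₀ hpi]
      rw [h3]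
      exact dsupport_smul_subset (dsupport_smul_subset
        ((TemperedDistribution.dsupport_lineDerivOp_subset m).trans h2) _) _
    · refine ⟨(TemperedDistribution.dsupport_lineDerivOp_subset v).trans h1, ?_⟩
      change dsupport (fourierD B hB (∂_{v} f)) ⊆ Z₂
      rw [fourierD_lineDeriv]
      exact dsupport_smul_subset ((TemperedDistribution.dsupport_smulLeftCLM_subset
        (hasTemperateGrowth_ofReal (LinearMap.toContinuousLinearMap (B v)))).trans h2) _
  | algebraMap c =>
    rintro f ⟨h1, h2⟩
    rw [Module.algebraMap_end_apply, map_smul]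
    exact ⟨dsupport_smul_subset h1 c, dsupport_smul_subset h2 c⟩
  | add D E _ _ hD hE =>
    intro f hf
    rw [LinearMap.add_apply, map_add]
    exact ⟨dsupport_add_subset (hD f hf).1 (hE f hf).1, dsupport_add_subset (hD f hf).2 (hE f hf).2⟩
  | mul D E _ _ hD hE =>
    intro f hf
    exact hD _ (hE f hf)

open Distribution in
/-- The `W[F]`-module of the tempered generalized functions on `F` which are supported in `Z₁` and
whose Fourier transform (with respect to `B`) is supported in `Z₂`; here `Z₁`, `Z₂` are closed. -/
def genFun (B : LinearMap.BilinForm ℝ F) (hB : B.Nondegenerate) (Z₁ Z₂ : Set F) :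
    Submodule (Weyl F) 𝓢'(F, ℂ) where
  carrier := {f | dsupport f ⊆ Z₁ ∧ dsupport (fourierD B hB f) ⊆ Z₂}
  zero_mem' := ⟨dsupport_zero_subset _, by rw [map_zero]; exact dsupport_zero_subset _⟩
  add_mem' hf hg := ⟨dsupport_add_subset hf.1 hg.1, by
    rw [map_add]; exact dsupport_add_subset hf.2 hg.2⟩
  smul_mem' D f hf := supported_weyl B hB Z₁ Z₂ (show weylOps F from D).2 f hf

end Weyl

/-- A subspace on which the form `B` vanishes identically. -/
def IsTotallyIsotropic (B : LinearMap.BilinForm ℝ F) (V : Submodule ℝ F) : Prop :=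
  ∀ x ∈ V, ∀ y ∈ V, B x y = 0

end QuadSpace

end

/-! For `v` in `F` let `X_v` be multiplication by `B v` (`formOp`) and `D_v` the derivative along
`v` (`derivOp`), so that `[D_w, X_v] = B v w`. The Fourier transform carries `D_v` to a nonzero
multiple of `X_v`, so both support conditions become conditions on these operators.

Translation: a tempered distribution has finite order, so one supported in a finite union of
subspaces is killed by every product of sufficiently high powers of equations of these subspaces
(`exists_prod_mulOp_apply_eq_zero`). Since `V i` is its own orthogonal complement, its equations are
the `B v` with `v` in `V i`. Hence membership in the module of a single `V i` means that all `X_v`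
and `D_v`, `v` in `V i`, act nilpotently on the element (`mem_genFun_lagrangian_iff`).

Decomposition: for `i ≠ j` some `v` in `V j` and `w` in `V i` have `B v w ≠ 0`. If `[d, a]` is a
nonzero scalar, an element on which both `a` and `d` are nilpotent modulo a stable subspace lies in
that subspace (`mem_of_pow_mem_of_commutator`). Peeling factors off the annihilating products in
this way shows that the module of the union is the sum of the modules of the `V i`
(`le_of_separated`).

Simplicity: on the module of one `V` the commuting operators `X_v`, `D_v`, `v` in `V`, are
annihilation operators, and those of a dual family are creation operators. Every nonzero submodule
contains a vacuum vector (`exists_vacuum`), the vacuum space is at most one-dimensional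
(`exists_vacuum_test`), and a creation-stable subspace containing all vacua is everything
(`mem_of_vacuum_mem`). So each summand is simple or zero, which is all that the semisimplicity
argument `semisimple_of_eq_iSup` requires. -/

noncomputable section

namespace QuadSpace

open MeasureTheory Module FourierTransform LineDeriv Filter Topology Distribution
open scoped ContDiff

/-! ### Finite order of tempered distributions, cutoffs and supports. -/

section Multipliers

variable {F : Type*} [NormedAddCommGroup F] [NormedSpace ℝ F]

/-- Multiplication by a function all of whose low order derivatives are small. -/
theorem seminorm_smulLeftCLM_le (k n : ℕ) (φ : 𝓢(F, ℂ)) {g : F → ℂ} (hg : g.HasTemperateGrowth)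
    {c : ℝ} (hc : 0 ≤ c) (hgc : ∀ j ≤ n, ∀ x, ‖iteratedFDeriv ℝ j g x‖ ≤ c * (1 + ‖x‖)) :
    SchwartzMap.seminorm ℂ k n (SchwartzMap.smulLeftCLM ℂ g φ) ≤
      (∑ i ∈ Finset.range (n + 1), (n.choose i : ℝ) * (SchwartzMap.seminorm ℂ k (n - i) φ +
        SchwartzMap.seminorm ℂ (k + 1) (n - i) φ)) * c := by
  have hpos : ∀ a b, 0 ≤ SchwartzMap.seminorm ℂ a b φ := fun a b => apply_nonneg _ _
  refine SchwartzMap.seminorm_le_bound ℂ k n _ (mul_nonneg (Finset.sum_nonneg fun i _ =>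
    mul_nonneg (Nat.cast_nonneg _) (add_nonneg (hpos _ _) (hpos _ _))) hc) fun x => ?_
  have hfun : (SchwartzMap.smulLeftCLM ℂ g φ : F → ℂ) = fun y => g y * φ y := by
    ext y; simp [SchwartzMap.smulLeftCLM_apply_apply hg]
  rw [hfun]
  have h1 := norm_iteratedFDeriv_mul_le (𝕜 := ℝ) (hg.1.of_le (by exact_mod_cast le_top))
    ((φ.smooth n)) x (n := n) le_rfl
  refine (mul_le_mul_of_nonneg_left h1 (by positivity)).trans ?_
  rw [Finset.mul_sum, Finset.sum_mul]
  refine Finset.sum_le_sum fun i hi => ?_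
  have hi' : i ≤ n := Nat.lt_succ_iff.1 (Finset.mem_range.1 hi)
  have h2 := hgc i hi' x
  have h3 := SchwartzMap.le_seminorm ℂ k (n - i) φ x
  have h4 := SchwartzMap.le_seminorm ℂ (k + 1) (n - i) φ x
  have h5 : ‖x‖ ^ k * ((n.choose i : ℝ) * ‖iteratedFDeriv ℝ i g x‖ *
      ‖iteratedFDeriv ℝ (n - i) φ x‖) ≤ ‖x‖ ^ k * ((n.choose i : ℝ) * (c * (1 + ‖x‖)) *
      ‖iteratedFDeriv ℝ (n - i) φ x‖) := by gcongr
  refine h5.trans ?_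
  have h6 : ‖x‖ ^ k * ((n.choose i : ℝ) * (c * (1 + ‖x‖)) * ‖iteratedFDeriv ℝ (n - i) φ x‖) =
    (n.choose i : ℝ) * (‖x‖ ^ k * ‖iteratedFDeriv ℝ (n - i) φ x‖ +
      ‖x‖ ^ (k + 1) * ‖iteratedFDeriv ℝ (n - i) φ x‖) * c := by ring
  rw [h6]
  gcongr

/-- A tempered distribution has finite order. -/
theorem exists_order (f : 𝓢'(F, ℂ)) : ∃ N : ℕ, ∀ φ : 𝓢(F, ℂ), ∃ C : ℝ,
    ∀ (g : F → ℂ), g.HasTemperateGrowth → ∀ c : ℝ, 0 ≤ c →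
      (∀ j ≤ N, ∀ x, ‖iteratedFDeriv ℝ j g x‖ ≤ c * (1 + ‖x‖)) →
        ‖f (SchwartzMap.smulLeftCLM ℂ g φ)‖ ≤ C * c := by
  obtain ⟨s, C, -, hs⟩ := Seminorm.bound_of_continuous (schwartz_withSeminorms ℂ F ℂ)
    ((normSeminorm ℂ ℂ).comp (f : 𝓢(F, ℂ) →ₗ[ℂ] ℂ)) (continuous_norm.comp (map_continuous f))
  let A : 𝓢(F, ℂ) → ℕ × ℕ → ℝ := fun φ m =>
    ∑ i ∈ Finset.range (m.2 + 1), (m.2.choose i : ℝ) * (SchwartzMap.seminorm ℂ m.1 (m.2 - i) φ +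
        SchwartzMap.seminorm ℂ (m.1 + 1) (m.2 - i) φ)
  have hA : ∀ φ m, 0 ≤ A φ m := fun φ m => Finset.sum_nonneg fun i _ =>
    mul_nonneg (Nat.cast_nonneg _) (add_nonneg (apply_nonneg _ _) (apply_nonneg _ _))
  -- The order is the largest number of derivatives in the finitely many seminorms that bound `f`.
  -- It does not depend on `φ`, while the constant does.
  refine ⟨s.sup Prod.snd, fun φ => ⟨C * ∑ m ∈ s, A φ m, fun g hg c hc hgc => ?_⟩⟩
  have h1 := hs (SchwartzMap.smulLeftCLM ℂ g φ)
  have h2 : (s.sup (schwartzSeminormFamily ℂ F ℂ)) (SchwartzMap.smulLeftCLM ℂ g φ) ≤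
      (∑ m ∈ s, A φ m) * c := by
    refine Seminorm.finset_sup_apply_le (mul_nonneg (Finset.sum_nonneg fun m _ => hA φ m) hc)
      fun m hm => ?_
    refine (seminorm_smulLeftCLM_le m.1 m.2 φ hg hc fun j hj x => hgc j (hj.trans
      (Finset.le_sup (f := Prod.snd) hm)) x).trans ?_
    exact mul_le_mul_of_nonneg_right (Finset.single_le_sum (fun m _ => hA φ m) hm) hc
  calc ‖f (SchwartzMap.smulLeftCLM ℂ g φ)‖ ≤
        C * (s.sup (schwartzSeminormFamily ℂ F ℂ)) (SchwartzMap.smulLeftCLM ℂ g φ) := h1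
    _ ≤ C * ((∑ m ∈ s, A φ m) * c) := by gcongr
    _ = _ := by ring

/-- Derivatives of the composition with a linear map. -/
theorem norm_iteratedFDeriv_comp_clm_le {E : Type*} [NormedAddCommGroup E] [NormedSpace ℝ E]
    {h : E → ℂ} (hh : ContDiff ℝ ∞ h) (l : F →L[ℝ] E) (j : ℕ) (x : F) :
    ‖iteratedFDeriv ℝ j (fun y => h (l y)) x‖ ≤ ‖iteratedFDeriv ℝ j h (l x)‖ * ‖l‖ ^ j := by
  have := l.iteratedFDeriv_comp_right hh x (i := j) (by exact_mod_cast le_top)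
  change ‖iteratedFDeriv ℝ j (h ∘ l) x‖ ≤ _
  rw [this]
  refine (ContinuousMultilinearMap.norm_compContinuousLinearMap_le _ _).trans ?_
  simp

theorem exists_bound_iteratedFDeriv {E : Type*} [NormedAddCommGroup E] [NormedSpace ℝ E]
    {h : E → ℂ} (hc : HasCompactSupport h) (hh : ContDiff ℝ ∞ h) (N : ℕ) :
    ∃ C : ℝ, 0 ≤ C ∧ ∀ j ≤ N, ∀ x, ‖iteratedFDeriv ℝ j h x‖ ≤ C := by
  refine ⟨∑ j ∈ Finset.range (N + 1), SchwartzMap.seminorm ℂ 0 j (hc.toSchwartzMap hh),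
    Finset.sum_nonneg fun j _ => apply_nonneg _ _, fun j hj x => ?_⟩
  refine (SchwartzMap.norm_iteratedFDeriv_le_seminorm ℂ (hc.toSchwartzMap hh) j x).trans ?_
  exact Finset.single_le_sum (f := fun j => SchwartzMap.seminorm ℂ 0 j (hc.toSchwartzMap hh))
    (fun j _ => apply_nonneg _ _) (Finset.mem_range.2 (Nat.lt_succ_of_le hj))

theorem contDiff_comp_clm_hasTemperateGrowth {E : Type*} [NormedAddCommGroup E] [NormedSpace ℝ E]
    {h : E → ℂ} (hc : HasCompactSupport h) (hh : ContDiff ℝ ∞ h) (l : F →L[ℝ] E) :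
    (fun y => h (l y)).HasTemperateGrowth :=
  (hc.hasTemperateGrowth hh).comp l.hasTemperateGrowth

/-- Cutting off at a hyperplane, to an order exceeding the order of the distribution. -/
theorem exists_tendsto_cutoff (f : 𝓢'(F, ℂ)) : ∃ K : ℕ, ∀ (l : F →L[ℝ] ℝ) (h : ℝ → ℂ),
    HasCompactSupport h → ContDiff ℝ ∞ h → ∀ φ : 𝓢(F, ℂ),
      Tendsto (fun ε : ℝ => f (SchwartzMap.smulLeftCLM ℂ
        (fun y => (ε : ℂ) ^ K * h (ε⁻¹ * l y)) φ)) (𝓝[>] 0) (𝓝 0) := by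
  obtain ⟨N, hN⟩ := exists_order f
  -- Each derivative of `h (ε⁻¹ * l y)` costs a factor `ε⁻¹`. At most `N` derivatives occur, so the
  -- power `N + 1` leaves one spare factor `ε`.
  refine ⟨N + 1, fun l h hc hh φ => ?_⟩
  obtain ⟨C, hC⟩ := hN φ
  obtain ⟨A, hA0, hA⟩ := exists_bound_iteratedFDeriv hc hh N
  have hlim : Tendsto (fun ε : ℝ => C * (ε * (A * (1 + ‖l‖) ^ N))) (𝓝[>] 0) (𝓝 0) := by
    have : Tendsto (fun ε : ℝ => C * (ε * (A * (1 + ‖l‖) ^ N))) (𝓝 0)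
        (𝓝 (C * (0 * (A * (1 + ‖l‖) ^ N)))) := Continuous.tendsto (by fun_prop) _
    simpa using this.mono_left nhdsWithin_le_nhds
  refine squeeze_zero_norm' ?_ hlim
  filter_upwards [Ioo_mem_nhdsGT (zero_lt_one (α := ℝ))] with ε ⟨hε, hε1⟩
  have hfun : (fun y => (ε : ℂ) ^ (N + 1) * h (ε⁻¹ * l y)) =
      (ε ^ (N + 1)) • fun y => h ((ε⁻¹ • l) y) := by
    ext y; simp
  have htg := contDiff_comp_clm_hasTemperateGrowth hc hh (ε⁻¹ • l)
  have hsm : ContDiff ℝ ∞ fun y => h ((ε⁻¹ • l) y) := htg.1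
  rw [hfun]
  refine hC _ ?_ _ (by positivity) fun j hj x => ?_
  · exact (Function.HasTemperateGrowth.const (ε ^ (N + 1))).smul htg
  rw [iteratedFDeriv_const_smul_apply (hsm.contDiffAt.of_le (by exact_mod_cast le_top)), norm_smul]
  have h1 := norm_iteratedFDeriv_comp_clm_le hh (ε⁻¹ • l) j x
  have h2 : ‖ε⁻¹ • l‖ ^ j = (ε⁻¹) ^ j * ‖l‖ ^ j := by
    rw [norm_smul, mul_pow, norm_inv, Real.norm_of_nonneg hε.le]
  have h3 : ‖l‖ ^ j ≤ (1 + ‖l‖) ^ N :=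
    (pow_le_pow_left₀ (norm_nonneg _) (by linarith) j).trans
      (pow_le_pow_right₀ (by linarith [norm_nonneg l]) hj)
  have h4 : ε ^ (N + 1) * ε⁻¹ ^ j ≤ ε := by
    have : ε ^ (N + 1) * ε⁻¹ ^ j = ε * (ε ^ (N - j)) := by
      rw [← Nat.sub_add_cancel hj]
      simp only [Nat.add_sub_cancel]
      rw [inv_pow, pow_succ, pow_add]
      field_simp
    rw [this]
    exact mul_le_of_le_one_right hε.le (pow_le_one₀ hε.le hε1.le)
  rw [norm_pow, Real.norm_of_nonneg hε.le]
  calc ε ^ (N + 1) * ‖iteratedFDeriv ℝ j (fun y => h ((ε⁻¹ • l) y)) x‖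
      ≤ ε ^ (N + 1) * (A * (ε⁻¹ ^ j * ‖l‖ ^ j)) := by
        rw [← h2]
        gcongr
        exact h1.trans (mul_le_mul_of_nonneg_right (hA j hj _) (by positivity))
    _ = (ε ^ (N + 1) * ε⁻¹ ^ j) * (A * ‖l‖ ^ j) := by ring
    _ ≤ ε * (A * (1 + ‖l‖) ^ N) := by gcongr
    _ ≤ ε * (A * (1 + ‖l‖) ^ N) * (1 + ‖x‖) :=
        le_mul_of_one_le_right (by positivity) (by linarith [norm_nonneg x])

variable [FiniteDimensional ℝ F]

/-- Cutting off at infinity. -/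
theorem tendsto_cutoff_infty (f : 𝓢'(F, ℂ)) (χ : ContDiffBump (0 : F)) (φ : 𝓢(F, ℂ)) :
    Tendsto (fun ε : ℝ => f (SchwartzMap.smulLeftCLM ℂ (fun y => (χ (ε • y) : ℂ)) φ))
      (𝓝[>] 0) (𝓝 (f φ)) := by
  obtain ⟨N, hN⟩ := exists_order f
  obtain ⟨C, hC⟩ := hN φ
  have hc : HasCompactSupport fun y => (χ y : ℂ) := χ.hasCompactSupport.comp_left (g := ((↑) : ℝ → ℂ)) rfl
  have hh : ContDiff ℝ ∞ fun y => (χ y : ℂ) := Complex.ofRealCLM.contDiff.comp χ.contDiff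
  obtain ⟨A, hA0, hA⟩ := exists_bound_iteratedFDeriv hc hh N
  have hr := χ.rIn_pos
  have hlim : Tendsto (fun ε : ℝ => C * (ε * (A + χ.rIn⁻¹))) (𝓝[>] 0) (𝓝 0) := by
    have : Tendsto (fun ε : ℝ => C * (ε * (A + χ.rIn⁻¹))) (𝓝 0)
        (𝓝 (C * (0 * (A + χ.rIn⁻¹)))) := Continuous.tendsto (by fun_prop) _
    simpa using this.mono_left nhdsWithin_le_nhds
  rw [← tendsto_sub_nhds_zero_iff]
  refine squeeze_zero_norm' ?_ hlim
  filter_upwards [Ioo_mem_nhdsGT (zero_lt_one (α := ℝ))] with ε ⟨hε, hε1⟩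
  set l : F →L[ℝ] F := ε • ContinuousLinearMap.id ℝ F with hl
  have htg := contDiff_comp_clm_hasTemperateGrowth hc hh l
  have hsm : ContDiff ℝ ∞ fun y => (χ (l y) : ℂ) := htg.1
  have htg1 : (fun _ : F => (1 : ℂ)).HasTemperateGrowth := .const 1
  have heq : f (SchwartzMap.smulLeftCLM ℂ (fun y => (χ (ε • y) : ℂ)) φ) - f φ =
      f (SchwartzMap.smulLeftCLM ℂ ((fun y => (χ (l y) : ℂ)) - fun _ => 1) φ) := by
    rw [SchwartzMap.smulLeftCLM_sub htg htg1, SchwartzMap.smulLeftCLM_const]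
    change _ = f (_ - (1 : ℂ) • φ)
    rw [one_smul, map_sub]
    rfl
  rw [heq]
  refine hC _ (htg.sub htg1) _ (by positivity) fun j hj x => ?_
  rcases Nat.eq_zero_or_pos j with rfl | hj0
  · rw [norm_iteratedFDeriv_zero]
    -- The difference is not uniformly small, only small relative to `1 + ‖x‖`; this is why
    -- `exists_order` allows linear growth of the multiplier.
    have h0 : ‖((χ (l x) : ℂ)) - 1‖ ≤ ε * χ.rIn⁻¹ * ‖x‖ := by
      by_cases hx : ε * ‖x‖ ≤ χ.rIn
      · have : χ (l x) = 1 := χ.one_of_mem_closedBall (by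
          simp [hl, norm_smul, abs_of_pos hε, hx])
        rw [this]; simp; positivity
      · have h1 : ‖((χ (l x) : ℂ)) - 1‖ ≤ 1 := by
          have : ((χ (l x) : ℂ)) - 1 = ((χ (l x) - 1 : ℝ) : ℂ) := by push_cast; ring
          rw [this, Complex.norm_real, Real.norm_eq_abs, abs_le]
          constructor <;> linarith [χ.nonneg (x := l x), χ.le_one (x := l x)]
        refine h1.trans ?_
        have : ε * χ.rIn⁻¹ * ‖x‖ = (ε * ‖x‖) / χ.rIn := by field_simp
        rw [this, le_div_iff₀ hr]
        linarith
    refine h0.trans ?_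
    have : ε * (A + χ.rIn⁻¹) * (1 + ‖x‖) = ε * χ.rIn⁻¹ * ‖x‖ + 
      (ε * A * ‖x‖ + ε * (A + χ.rIn⁻¹)) := by ring
    rw [this]
    have : 0 ≤ (ε * A * ‖x‖ + ε * (A + χ.rIn⁻¹)) := by positivity
    linarith
  · have hd : iteratedFDeriv ℝ j ((fun y => (χ (l y) : ℂ)) - fun _ => 1) x =
        iteratedFDeriv ℝ j (fun y => (χ (l y) : ℂ)) x := by
      rw [iteratedFDeriv_sub_apply (hsm.contDiffAt.of_le (by exact_mod_cast le_top)) contDiffAt_const,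
        iteratedFDeriv_const_of_ne hj0.ne']
      simp
    rw [hd]
    have h1 := norm_iteratedFDeriv_comp_clm_le hh l j x
    have h2 : ‖l‖ ^ j ≤ ε := by
      have : ‖l‖ ≤ ε := by
        rw [hl, norm_smul, Real.norm_of_nonneg hε.le]
        exact mul_le_of_le_one_right hε.le ContinuousLinearMap.norm_id_le
      calc ‖l‖ ^ j ≤ ε ^ j := pow_le_pow_left₀ (norm_nonneg _) this j
        _ ≤ ε ^ 1 := pow_le_pow_of_le_one hε.le hε1.le hj0
        _ = ε := pow_one ε
    calc _ ≤ A * ε := h1.trans (mul_le_mul (hA j hj _) h2 (by positivity) hA0)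
      _ ≤ ε * (A + χ.rIn⁻¹) * (1 + ‖x‖) := by
        have : ε * (A + χ.rIn⁻¹) * (1 + ‖x‖) = A * ε + (ε * A * ‖x‖ + ε * χ.rIn⁻¹ * (1 + ‖x‖)) := by
          ring
        rw [this]
        have : 0 ≤ (ε * A * ‖x‖ + ε * χ.rIn⁻¹ * (1 + ‖x‖)) := by positivity
        linarith

theorem hasCompactSupport_cutoff (χ : ContDiffBump (0 : F)) {ε : ℝ} (hε : 0 < ε) (φ : 𝓢(F, ℂ)) :
    HasCompactSupport (SchwartzMap.smulLeftCLM ℂ (fun y => (χ (ε • y) : ℂ)) φ) := by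
  have hc : HasCompactSupport fun y => (χ (ε • y) : ℂ) :=
    ((χ.hasCompactSupport.comp_left (g := ((↑) : ℝ → ℂ)) rfl).comp_homeomorph
      (Homeomorph.smulOfNeZero ε hε.ne'))
  rw [HasCompactSupport]
  refine IsCompact.of_isClosed_subset hc (isClosed_tsupport _) ?_
  exact (SchwartzMap.tsupport_smulLeftCLM_subset _ _).trans Set.inter_subset_right

/-- A statement about compactly supported test functions that is stable under cutting off. -/
theorem apply_eq_zero_of_hasCompactSupport (f : 𝓢'(F, ℂ)) (φ : 𝓢(F, ℂ))
    (h : ∀ g : F → ℂ, g.HasTemperateGrowth →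
      HasCompactSupport (SchwartzMap.smulLeftCLM ℂ g φ) →
        f (SchwartzMap.smulLeftCLM ℂ g φ) = 0) : f φ = 0 := by
  let χ : ContDiffBump (0 : F) := default
  refine tendsto_nhds_unique (tendsto_cutoff_infty f χ φ) ?_
  refine Tendsto.congr' ?_ tendsto_const_nhds
  filter_upwards [self_mem_nhdsWithin] with ε hε
  have hc : HasCompactSupport fun y => (χ y : ℂ) := χ.hasCompactSupport.comp_left (g := ((↑) : ℝ → ℂ)) rfl
  have hh : ContDiff ℝ ∞ fun y => (χ y : ℂ) := Complex.ofRealCLM.contDiff.comp χ.contDiff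
  exact (h _ (contDiff_comp_clm_hasTemperateGrowth hc hh (ε • ContinuousLinearMap.id ℝ F))
    (hasCompactSupport_cutoff χ hε φ)).symm

/-- A distribution vanishes on the complement of its support. -/
theorem apply_eq_zero_of_disjoint_dsupport (f : 𝓢'(F, ℂ)) (φ : 𝓢(F, ℂ))
    (hφ : HasCompactSupport φ) (hd : Disjoint (tsupport φ) (dsupport f)) : f φ = 0 := by
  have h1 : ∀ x : tsupport φ, ∃ s : Set F, IsVanishingOn f s ∧ IsOpen s ∧ x.1 ∈ s := fun x =>
    (notMem_dsupport_iff x.1).1 (Set.disjoint_left.1 hd x.2)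
  choose U hU hUo hxU using h1
  obtain ⟨t, ht⟩ := IsCompact.elim_finite_subcover hφ U hUo
    (fun x hx => Set.mem_iUnion.2 ⟨⟨x, hx⟩, hxU _⟩)
  obtain ⟨ρ, hρ⟩ := SmoothPartitionOfUnity.exists_isSubordinate (modelWithCornersSelf ℝ F)
    (isClosed_tsupport φ) (fun i : t => U i) (fun i => hUo i) (by
      intro x hx
      obtain ⟨i, hi, hxi⟩ := Set.mem_iUnion₂.1 (ht hx)
      exact Set.mem_iUnion.2 ⟨⟨i, hi⟩, hxi⟩)
  have hsmooth : ∀ i : t, ContDiff ℝ ∞ fun x => (ρ i x : ℂ) * φ x := fun i =>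
    (Complex.ofRealCLM.contDiff.comp (ρ i).contMDiff.contDiff).mul (φ.smooth ⊤)
  have hcpt : ∀ i : t, HasCompactSupport fun x => (ρ i x : ℂ) * φ x := fun i => hφ.mul_left
  have hsum : φ = ∑ i : t, (hcpt i).toSchwartzMap (hsmooth i) := by
    ext x
    rw [sum_apply]
    simp only [HasCompactSupport.toSchwartzMap_toFun]
    by_cases hx : x ∈ tsupport φ
    · have := ρ.sum_eq_one hx
      rw [finsum_eq_sum_of_fintype] at this
      rw [← Finset.sum_mul, ← Complex.ofReal_sum, this]
      simp
    · simp [image_eq_zero_of_notMem_tsupport hx]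
  rw [hsum, map_sum]
  refine Finset.sum_eq_zero fun i _ => hU i _ ?_
  refine Set.Subset.trans ?_ (hρ i)
  refine (closure_mono ?_)
  intro x hx
  contrapose! hx
  simp only [Function.mem_support, not_not] at hx ⊢
  change (ρ i x : ℂ) * φ x = 0
  simp [hx]

end Multipliers

/-! ### Operators with scalar commutators: nilpotency, vacuum vectors, the Euler operator. -/

section Algebra

variable {E : Type*} [AddCommGroup E] [Module ℂ E]

theorem pow_succ_mul_of_commutator {a d : End ℂ E} {c : ℂ} (h : d * a = a * d + c • 1) (k : ℕ) :
    d ^ (k + 1) * a = a * d ^ (k + 1) + (((k : ℂ) + 1) * c) • d ^ k := by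
  induction k with
  | zero => simpa using h
  | succ k ih =>
    rw [pow_succ' d (k + 1), mul_assoc, ih, mul_add, ← mul_assoc, h, add_mul, mul_assoc,
      mul_smul_comm, ← pow_succ', ← pow_succ', smul_mul_assoc, one_mul, add_assoc, ← add_smul]
    congr 2
    push_cast
    ring

/-- If `[d, a]` is a nonzero scalar, then only elements of the stable subspace `N` are nilpotent
modulo `N` for both `a` and `d`. -/
theorem mem_of_pow_mem_of_commutator {a d : End ℂ E} {c : ℂ} (h : d * a = a * d + c • 1)
    (hc : c ≠ 0) (N : Submodule ℂ E) (ha : ∀ x ∈ N, a x ∈ N) (hd : ∀ x ∈ N, d x ∈ N)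
    {n m : ℕ} {g : E} (hn : (a ^ n) g ∈ N) (hm : (d ^ m) g ∈ N) : g ∈ N := by
  have key : ∀ (k : ℕ) (g : E), (d ^ (k + 1)) (a g) = a ((d ^ (k + 1)) g) + (((k : ℂ) + 1) * c) • (d ^ k) g :=
    fun k g => congrArg (fun T : End ℂ E => T g) (pow_succ_mul_of_commutator h k)
  -- The case of a single factor `a`. In `d ^ (m+1) a g = a d ^ (m+1) g + (m+1) c d ^ m g` every
  -- term but the last is known to lie in `N`, so the exponent of `d` can be lowered step by step to
  -- zero.
  have hone : ∀ m g, a g ∈ N → (d ^ m) g ∈ N → g ∈ N := by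
    intro m
    induction m with
    | zero => intro g _ hg; simpa using hg
    | succ m ih =>
      intro g hag hg
      refine ih g hag ?_
      have h1 : (d ^ (m + 1)) (a g) ∈ N := by
        have : ∀ k, ∀ x ∈ N, (d ^ k) x ∈ N := fun k => by
          induction k with
          | zero => intro x hx; simpa using hx
          | succ k ih => intro x hx; rw [pow_succ']; exact hd _ (ih x hx)
        exact this _ _ hag
      rw [key, N.add_mem_iff_right (ha _ hg)] at h1
      refine (N.smul_mem_iff (mul_ne_zero ?_ hc)).1 h1
      exact Nat.cast_add_one_ne_zero m
  induction n generalizing m g with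
  | zero => simpa using hn
  | succ n ih =>
    refine hone m g (ih (m := m + 1) (by simpa [pow_succ] using hn) ?_) hm
    rw [key]
    refine N.add_mem (ha _ ?_) (N.smul_mem _ hm)
    rw [pow_succ']
    exact hd _ hm

/-- Nilpotency is preserved by operators with a scalar commutator. -/
theorem exists_pow_apply_eq_zero {a d : End ℂ E} {c : ℂ} (h : d * a = a * d + c • 1) {g : E}
    (hg : ∃ m, (d ^ m) g = 0) : ∃ m, (d ^ m) (a g) = 0 := by
  obtain ⟨m, hm⟩ := hg
  refine ⟨m + 1, ?_⟩
  have := congrArg (fun T : End ℂ E => T g) (pow_succ_mul_of_commutator h m)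
  refine this.trans ?_
  change a ((d ^ (m + 1)) g) + (((m : ℂ) + 1) * c) • (d ^ m) g = 0
  rw [pow_succ', hm]
  simp [hm]

/-- Moving one `a` past a power of `d` costs only one extra power of `d`. This is the preceding
nilpotency statement, taken modulo a stable subspace. -/
theorem exists_pow_apply_mem {a d : End ℂ E} {c : ℂ} (h : d * a = a * d + c • 1)
    (N : Submodule ℂ E) (ha : ∀ x ∈ N, a x ∈ N) (hd : ∀ x ∈ N, d x ∈ N) {g : E}
    (hg : ∃ m, (d ^ m) g ∈ N) : ∃ m, (d ^ m) (a g) ∈ N := by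
  obtain ⟨m, hm⟩ := hg
  refine ⟨m + 1, ?_⟩
  have := congrArg (fun T : End ℂ E => T g) (pow_succ_mul_of_commutator h m)
  rw [show (d ^ (m + 1)) (a g) = _ from this]
  refine N.add_mem (ha _ ?_) (N.smul_mem _ hm)
  rw [pow_succ']
  exact hd _ hm

theorem pow_apply_mem {a : End ℂ E} (N : Submodule ℂ E) (ha : ∀ x ∈ N, a x ∈ N) (k : ℕ) :
    ∀ x ∈ N, (a ^ k) x ∈ N := by
  induction k with
  | zero => intro x hx; simpa using hx
  | succ k ih => intro x hx; rw [pow_succ']; exact ha _ (ih x hx)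

/-- Commuting operators define a module over the polynomial ring. -/
theorem exists_algHom_of_commute {ι : Type*} (a : ι → End ℂ E) (h : ∀ i j, a i * a j = a j * a i) :
    ∃ ρ : MvPolynomial ι ℂ →ₐ[ℂ] End ℂ E, ∀ i, ρ (MvPolynomial.X i) = a i := by
  have hs : ∀ x ∈ Set.range a, ∀ y ∈ Set.range a, x * y = y * x := by
    rintro _ ⟨i, rfl⟩ _ ⟨j, rfl⟩
    exact h i j
  let _ : CommRing (Algebra.adjoin ℂ (Set.range a)) :=
    { (inferInstance : Ring (Algebra.adjoin ℂ (Set.range a))) with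
      mul_comm := (Algebra.isMulCommutative_adjoin ℂ hs).is_comm.comm }
  refine ⟨(Algebra.adjoin ℂ (Set.range a)).val.comp (MvPolynomial.aeval fun i =>
    (⟨a i, Algebra.subset_adjoin ⟨i, rfl⟩⟩ : Algebra.adjoin ℂ (Set.range a))), fun i => ?_⟩
  simp

/-- The Euler operator argument: a subspace stable under raising operators that contains all vacuum
vectors contains everything. -/
theorem mem_of_vacuum_mem {ι : Type*} [Finite ι] (a b : ι → End ℂ E)
    (haa : ∀ i j, a i * a j = a j * a i) (hab : ∀ i, a i * b i = b i * a i + 1)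
    (hab' : ∀ i j, i ≠ j → a i * b j = b j * a i) (M N : Submodule ℂ E)
    (haM : ∀ i, ∀ x ∈ M, a i x ∈ M) (hbM : ∀ i, ∀ x ∈ M, b i x ∈ M)
    (hbN : ∀ i, ∀ x ∈ N, b i x ∈ N) (hnil : ∀ i, ∀ x ∈ M, ∃ n, (a i ^ n) x = 0)
    (hvac : ∀ x ∈ M, (∀ i, a i x = 0) → x ∈ N) : M ≤ N := by
  classical
  have := Fintype.ofFinite ι
  suffices h : ∀ s : Finset ι, ∀ x ∈ M, (∀ i ∉ s, a i x = 0) → x ∈ N from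
    fun x hx => h Finset.univ x hx (fun i hi => absurd (Finset.mem_univ i) hi)
  intro s
  induction s using Finset.induction_on with
  | empty => exact fun x hx h => hvac x hx fun i => h i (Finset.notMem_empty i)
  | insert i s his ih =>
    intro x hx h
    obtain ⟨n, hn⟩ := hnil i x hx
    induction n generalizing x with
    | zero =>
      have : x = 0 := by simpa using hn
      rw [this]
      exact N.zero_mem
    | succ n ihn =>
      have hcomm : ∀ j x, a j (a i x) = a i (a j x) := fun j x =>
        congrArg (fun T : End ℂ E => T x) (haa j i)
      have hax : a i x ∈ N := by
        refine ihn (a i x) (haM i x hx) (fun j hj => ?_) (by simpa [pow_succ] using hn)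
        rw [hcomm, h j hj, map_zero]
      rcases Nat.eq_zero_or_pos n with rfl | hpos
      · refine ih x hx fun j hj => ?_
        by_cases hji : j = i
        · subst hji; simpa using hn
        · exact h j (by simp [hji, hj])
      · have hbax := hbN i _ hax
        -- The operator `b i * a i` counts particles: on vectors killed by `a i ^ (n + 1)` it equals
        -- `n` modulo vectors killed by `a i ^ n`, to which the induction applies. As `b i (a i x)`
        -- is in `N` too, so is `n • x`.
        have hdiff : b i (a i x) - (n : ℂ) • x ∈ N := by
          refine ihn _ (M.sub_mem (hbM i _ (haM i x hx)) (M.smul_mem _ hx)) (fun j hj => ?_) ?_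
          · have hji : j ≠ i := fun hji => hj (by simp [hji])
            have h1 : a j (b i (a i x)) = b i (a j (a i x)) :=
              congrArg (fun T : End ℂ E => T (a i x)) (hab' j i hji)
            rw [map_sub, map_smul, h1, hcomm, h j hj]
            simp
          · obtain ⟨m, rfl⟩ := Nat.exists_eq_succ_of_ne_zero hpos.ne'
            have h2 := pow_succ_mul_of_commutator (a := b i) (d := a i) (c := 1)
              (by rw [one_smul]; exact hab i) m
            have h3 := congrArg (fun T : End ℂ E => T (a i x)) h2
            change (a i ^ (m + 1)) (b i (a i x)) = b i ((a i ^ (m + 1)) (a i x)) +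
              (((m : ℂ) + 1) * 1) • (a i ^ m) (a i x) at h3
            have h4 : (a i ^ (m + 1)) (a i x) = 0 := by simpa [pow_succ] using hn
            have h5 : (a i ^ m) (a i x) = (a i ^ (m + 1)) x := by simp [pow_succ]
            rw [map_sub, map_smul]
            change (a i ^ (m + 1)) (b i (a i x)) - _ = 0
            rw [h3, h4, h5]
            simp
        have := N.sub_mem hbax hdiff
        rw [sub_sub_cancel] at this
        exact (N.smul_mem_iff (Nat.cast_ne_zero.2 hpos.ne')).1 this

/-- Commuting locally nilpotent operators have a common kernel vector. -/
theorem exists_vacuum {ι : Type*} [Finite ι] (a : ι → End ℂ E)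
    (haa : ∀ i j, a i * a j = a j * a i) (N : Submodule ℂ E) (haN : ∀ i, ∀ x ∈ N, a i x ∈ N)
    (hnil : ∀ i, ∀ x ∈ N, ∃ n, (a i ^ n) x = 0) (hN : N ≠ ⊥) :
    ∃ x ∈ N, x ≠ 0 ∧ ∀ i, a i x = 0 := by
  classical
  have := Fintype.ofFinite ι
  suffices h : ∀ s : Finset ι, ∃ x ∈ N, x ≠ 0 ∧ ∀ i ∈ s, a i x = 0 by
    obtain ⟨x, hx, hx0, h⟩ := h Finset.univ
    exact ⟨x, hx, hx0, fun i => h i (Finset.mem_univ i)⟩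
  intro s
  induction s using Finset.induction_on with
  | empty =>
    obtain ⟨x, hx, hx0⟩ := N.exists_mem_ne_zero_of_ne_bot hN
    exact ⟨x, hx, hx0, by simp⟩
  | insert i s his ih =>
    obtain ⟨x, hx, hx0, h⟩ := ih
    -- The last nonzero power of `a i` applied to `x` is killed by `a i`, and commutation keeps it
    -- in the kernels already obtained.
    have hex := hnil i x hx
    have hn := Nat.find_spec hex
    have hpos : Nat.find hex ≠ 0 := fun h0 => hx0 (by simpa [h0] using hn)
    obtain ⟨n, hn'⟩ := Nat.exists_eq_succ_of_ne_zero hpos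
    refine ⟨(a i ^ n) x, pow_apply_mem N (haN i) n x hx,
      Nat.find_min hex (by omega), fun j hj => ?_⟩
    rcases Finset.mem_insert.1 hj with rfl | hj
    · rw [hn', Nat.succ_eq_add_one, pow_succ'] at hn
      exact hn
    · have : Commute (a j) (a i ^ n) := Commute.pow_right (haa j i) n
      have := congrArg (fun T : End ℂ E => T x) this.eq
      change a j ((a i ^ n) x) = (a i ^ n) (a j x) at this
      rw [this, h j hj, map_zero]

end Algebra

/-! ### Splitting a module along pairwise separated families of operators. -/

section Decomposition

variable {E G ι : Type*} [AddCommGroup E] [Module ℂ E]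

theorem algHom_apply_mem {a : G → End ℂ E} {ρ : MvPolynomial G ℂ →ₐ[ℂ] End ℂ E}
    (hρ : ∀ v, ρ (MvPolynomial.X v) = a v) (M : Submodule ℂ E) (ha : ∀ v, ∀ x ∈ M, a v x ∈ M)
    (p : MvPolynomial G ℂ) : ∀ x ∈ M, ρ p x ∈ M := by
  induction p using MvPolynomial.induction_on with
  | C c =>
    intro x hx
    rw [← MvPolynomial.algebraMap_eq, AlgHom.commutes, Module.algebraMap_end_apply]
    exact M.smul_mem c hx
  | add p q hp hq =>
    intro x hx
    rw [map_add]
    exact M.add_mem (hp x hx) (hq x hx)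
  | mul_X p v hp =>
    intro x hx
    rw [map_mul, hρ]
    exact hp _ (ha v x hx)

/-- Factors that are invertible modulo nilpotency can be peeled off. -/
theorem mem_of_prod_apply_mem {a d : G → End ℂ E} {γ : G → G → ℂ}
    (had : ∀ v w, d w * a v = a v * d w + γ v w • 1)
    {ρ : MvPolynomial G ℂ →ₐ[ℂ] End ℂ E} (hρ : ∀ v, ρ (MvPolynomial.X v) = a v)
    (N : Submodule ℂ E) (ha : ∀ v, ∀ x ∈ N, a v x ∈ N) (hd : ∀ v, ∀ x ∈ N, d v x ∈ N)
    (v : ι → G) (K : ℕ) (S : Finset ι) (y : E)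
    (hS : ∀ j ∈ S, ∃ w, γ (v j) w ≠ 0 ∧ ∃ m, (d w ^ m) y ∈ N)
    (hy : ρ (∏ j ∈ S, MvPolynomial.X (v j) ^ K) y ∈ N) : y ∈ N := by
  classical
  induction S using Finset.induction_on generalizing y with
  | empty => simpa using hy
  | insert i S hi ih =>
    have hstep : (a (v i) ^ K) y ∈ N := by
      refine ih _ (fun j hj => ?_) ?_
      · obtain ⟨w, hw, hm⟩ := hS j (Finset.mem_insert_of_mem hj)
        refine ⟨w, hw, ?_⟩
        clear hy hw ih
        induction K with
        | zero => simpa using hm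
        | succ K ihK =>
          rw [pow_succ']
          exact exists_pow_apply_mem (had (v i) w) N (ha _) (hd _) ihK
      · rw [Finset.prod_insert hi, mul_comm, map_mul, map_pow, hρ] at hy
        exact hy
    obtain ⟨w, hw, m, hm⟩ := hS i (Finset.mem_insert_self i S)
    exact mem_of_pow_mem_of_commutator (had (v i) w) hw N (ha _) (hd _) hstep hm

variable [Fintype ι] [DecidableEq ι]

/-- Applying the `d`-factors of all indices other than `i` leaves a vector on which `d v` is
nilpotent for `v` in `V i`. That nilpotency then forces nilpotency of the `a v`: in an annihilating
product of `a`'s, the factors from the other `V j` pair nontrivially with some `d w`, `w` in `V i`,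
and can be removed. The result is a vector belonging to the `i`-th summand. -/
theorem exists_prod_apply_nilpotent {a d : G → End ℂ E} {γ : G → G → ℂ}
    (had : ∀ v w, d w * a v = a v * d w + γ v w • 1)
    {ρa ρd : MvPolynomial G ℂ →ₐ[ℂ] End ℂ E} (hρa : ∀ v, ρa (MvPolynomial.X v) = a v)
    (hρd : ∀ v, ρd (MvPolynomial.X v) = d v) (V : ι → Set G)
    (hsep : ∀ i j, i ≠ j → ∃ v ∈ V j, ∃ w ∈ V i, γ v w ≠ 0)
    (hne : ∀ i, (V i).Nonempty)
    (M : Submodule ℂ E) (hdM : ∀ v, ∀ x ∈ M, d v x ∈ M)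
    (hMa : ∀ f ∈ M, ∃ K : ℕ, ∀ v : ι → G, (∀ j, v j ∈ V j) →
      ρa (∏ j, MvPolynomial.X (v j) ^ K) f = 0)
    (hMd : ∀ f ∈ M, ∃ K : ℕ, ∀ v : ι → G, (∀ j, v j ∈ V j) →
      ρd (∏ j, MvPolynomial.X (v j) ^ K) f = 0)
    (f : E) (hf : f ∈ M) (i : ι) :
    ∃ K : ℕ, ∀ u : ι → G, (∀ j, u j ∈ V j) →
      ρd (∏ j ∈ Finset.univ.erase i, MvPolynomial.X (u j) ^ K) f ∈ M ∧
      (∀ v ∈ V i, ∃ k, (a v ^ k) (ρd (∏ j ∈ Finset.univ.erase i,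
        MvPolynomial.X (u j) ^ K) f) = 0) ∧
      (∀ v ∈ V i, ∃ k, (d v ^ k) (ρd (∏ j ∈ Finset.univ.erase i,
        MvPolynomial.X (u j) ^ K) f) = 0) := by
  obtain ⟨K, hK⟩ := hMd f hf
  refine ⟨K, fun u hu => ?_⟩
  set h := ρd (∏ j ∈ Finset.univ.erase i, MvPolynomial.X (u j) ^ K) f with hh
  have hhM : h ∈ M := algHom_apply_mem hρd M hdM _ f hf
  have hprod : ∀ (v : ι → G) (x : G) (k : ℕ) (T : MvPolynomial G ℂ →ₐ[ℂ] End ℂ E) (y : E),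
      T (∏ j, MvPolynomial.X (Function.update v i x j) ^ k) y =
        (T (MvPolynomial.X x) ^ k) (T (∏ j ∈ Finset.univ.erase i,
          MvPolynomial.X (v j) ^ k) y) := by
    intro v x k T y
    rw [← Finset.mul_prod_erase _ _ (Finset.mem_univ i), map_mul, map_pow]
    simp only [Function.update_self]
    rw [Finset.prod_congr rfl fun j hj => by rw [Function.update_of_ne (Finset.ne_of_mem_erase hj)]]
    rfl
  have hupd : ∀ (v : ι → G), (∀ j, v j ∈ V j) → ∀ x ∈ V i, ∀ j, Function.update v i x j ∈ V j := by
    intro v hv x hx j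
    by_cases hj : j = i
    · subst hj; simpa using hx
    · simpa [Function.update_of_ne hj] using hv j
  have hd0 : ∀ v ∈ V i, (d v ^ K) h = 0 := fun v hv => by
    have := hK (Function.update u i v) (hupd u hu v hv)
    rwa [hprod, hρd] at this
  refine ⟨hhM, fun v hv => ?_, fun v hv => ⟨K, hd0 v hv⟩⟩
  obtain ⟨K', hK'⟩ := hMa h hhM
  refine ⟨K', ?_⟩
  have hex : ∀ j, ∃ x ∈ V j, j ≠ i → ∃ w ∈ V i, γ x w ≠ 0 := fun j => by
    by_cases hj : j = i
    · obtain ⟨x, hx⟩ := hne j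
      exact ⟨x, hx, fun h => absurd hj h⟩
    · obtain ⟨x, hx, hw⟩ := hsep i j (Ne.symm hj)
      exact ⟨x, hx, fun _ => hw⟩
  choose x hxV hx using hex
  have h1 := hK' (Function.update x i v) (hupd x hxV v hv)
  rw [hprod, hρa] at h1
  have h2 : (a v ^ K') (ρa (∏ j ∈ Finset.univ.erase i, MvPolynomial.X (x j) ^ K') h) =
      ρa (∏ j ∈ Finset.univ.erase i, MvPolynomial.X (x j) ^ K') ((a v ^ K') h) := by
    rw [← hρa, ← map_pow]
    change (ρa _ * ρa _) h = (ρa _ * ρa _) h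
    rw [← map_mul, ← map_mul, mul_comm]
  rw [h2] at h1
  -- Peeling with `N = ⊥` from the vector `(a v ^ K') h`. Here `d w` is nilpotent on `h`, and
  -- remains so after powers of `a v`.
  refine (Submodule.mem_bot ℂ).1 (mem_of_prod_apply_mem had hρa ⊥ (by simp) (by simp) x K'
    (Finset.univ.erase i) _ (fun j hj => ?_) ((Submodule.mem_bot ℂ).2 h1))
  obtain ⟨w, hw, hγ⟩ := hx j (Finset.ne_of_mem_erase hj)
  refine ⟨w, hγ, ?_⟩
  simp only [Submodule.mem_bot]
  generalize K' = k
  induction k with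
  | zero => exact ⟨K, by simpa using hd0 w hw⟩
  | succ k ih =>
    rw [pow_succ']
    exact exists_pow_apply_eq_zero (had v w) ih

/-- A module with coordinate and Fourier support in a union of Lagrangian subspaces is the sum of
its parts supported in one of them. -/
theorem le_of_separated {a d : G → End ℂ E} {γ : G → G → ℂ}
    (had : ∀ v w, d w * a v = a v * d w + γ v w • 1)
    {ρa ρd : MvPolynomial G ℂ →ₐ[ℂ] End ℂ E} (hρa : ∀ v, ρa (MvPolynomial.X v) = a v)
    (hρd : ∀ v, ρd (MvPolynomial.X v) = d v) (V : ι → Set G)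
    (hsep : ∀ i j, i ≠ j → ∃ v ∈ V j, ∃ w ∈ V i, γ v w ≠ 0 ∧ γ w v ≠ 0)
    (hne : ∀ i, (V i).Nonempty)
    (M N : Submodule ℂ E) (haM : ∀ v, ∀ x ∈ M, a v x ∈ M) (hdM : ∀ v, ∀ x ∈ M, d v x ∈ M)
    (haN : ∀ v, ∀ x ∈ N, a v x ∈ N) (hdN : ∀ v, ∀ x ∈ N, d v x ∈ N)
    (hMa : ∀ f ∈ M, ∃ K : ℕ, ∀ v : ι → G, (∀ j, v j ∈ V j) →
      ρa (∏ j, MvPolynomial.X (v j) ^ K) f = 0)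
    (hMd : ∀ f ∈ M, ∃ K : ℕ, ∀ v : ι → G, (∀ j, v j ∈ V j) →
      ρd (∏ j, MvPolynomial.X (v j) ^ K) f = 0)
    (hN : ∀ i, ∀ f ∈ M, (∀ v ∈ V i, ∃ k, (a v ^ k) f = 0) → (∀ v ∈ V i, ∃ k, (d v ^ k) f = 0) →
      f ∈ N) : M ≤ N := by
  -- The same relation with the roles of `a` and `d` exchanged, so that `d`-factors can be peeled
  -- off by means of the `a`'s.
  have hda : ∀ v w, a w * d v = d v * a w + (-γ w v) • 1 := fun v w => by
    rw [had w v, neg_smul]; abel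
  -- The product of `d`-factors from the indices other than `i` sends `f` into the `i`-th part,
  -- hence into `N`. Each such factor pairs nontrivially with some `a w`, `w` in `V i`, which is
  -- nilpotent on `f` modulo `N`, so the factors can be removed.
  have hb : ∀ i, ∀ f ∈ M, (∀ v ∈ V i, ∃ k, (a v ^ k) f ∈ N) → f ∈ N := by
    intro i f hf h
    obtain ⟨K, hK⟩ := exists_prod_apply_nilpotent had hρa hρd V (fun i j hij => by
      obtain ⟨v, hv, w, hw, hγ, -⟩ := hsep i j hij
      exact ⟨v, hv, w, hw, hγ⟩) hne M hdM hMa hMd f hf i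
    have hex : ∀ j, ∃ x ∈ V j, j ≠ i → ∃ w ∈ V i, γ w x ≠ 0 := fun j => by
      by_cases hj : j = i
      · obtain ⟨x, hx⟩ := hne j
        exact ⟨x, hx, fun h => absurd hj h⟩
      · obtain ⟨x, hx, w, hw, -, hγ⟩ := hsep i j (Ne.symm hj)
        exact ⟨x, hx, fun _ => ⟨w, hw, hγ⟩⟩
    choose x hxV hx using hex
    obtain ⟨h1, h2, h3⟩ := hK x hxV
    refine mem_of_prod_apply_mem hda hρd N hdN haN x K (Finset.univ.erase i) f (fun j hj => ?_)
      (hN i _ h1 h2 h3)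
    obtain ⟨w, hw, hγ⟩ := hx j (Finset.ne_of_mem_erase hj)
    exact ⟨w, neg_ne_zero.2 hγ, h w hw⟩
  intro f hf
  obtain ⟨K, hK⟩ := hMa f hf
  -- The annihilating product of `a`'s is shortened one index at a time: once the `i`-th factor puts
  -- the vector in `N` for every choice of `x` in `V i`, `hb` makes that factor superfluous. The
  -- quantifier over all `v` is what keeps this choice free.
  suffices hc : ∀ (S : Finset ι), ∀ f ∈ M, (∀ v : ι → G, (∀ j, v j ∈ V j) →
      ρa (∏ j ∈ S, MvPolynomial.X (v j) ^ K) f ∈ N) → f ∈ N from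
    hc Finset.univ f hf fun v hv => by rw [hK v hv]; exact N.zero_mem
  clear hK hf f
  intro S
  induction S using Finset.induction_on with
  | empty =>
    intro f hf h
    choose v hv using hne
    simpa using h v hv
  | insert i S hi ih =>
    intro f hf h
    refine ih f hf fun v hv => ?_
    refine hb i _ (algHom_apply_mem hρa M haM _ f hf) fun x hx => ⟨K, ?_⟩
    have h1 := h (Function.update v i x) (fun j => by
      by_cases hj : j = i
      · subst hj; simpa using hx
      · simpa [Function.update_of_ne hj] using hv j)
    have h2 : ∏ j ∈ S, (MvPolynomial.X (Function.update v i x j) : MvPolynomial G ℂ) ^ K =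
        ∏ j ∈ S, MvPolynomial.X (v j) ^ K := Finset.prod_congr rfl fun j hj => by
      rw [Function.update_of_ne (ne_of_mem_of_not_mem hj hi)]
    rw [Finset.prod_insert hi, map_mul, map_pow, hρa, Function.update_self, h2] at h1
    exact h1

end Decomposition

/-! ### Multiplication and derivation operators; supports in terms of powers of equations. -/

section Operators

variable {F : Type*} [NormedAddCommGroup F] [NormedSpace ℝ F] [FiniteDimensional ℝ F]

theorem mulOp_apply (l : F →L[ℝ] ℝ) (f : 𝓢'(F, ℂ)) (φ : 𝓢(F, ℂ)) :
    mulOp l f φ = f (SchwartzMap.smulLeftCLM ℂ (fun x => (l x : ℂ)) φ) := rfl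

theorem derivOp_apply (v : F) (f : 𝓢'(F, ℂ)) (φ : 𝓢(F, ℂ)) :
    derivOp v f φ = f (-(∂_{v} φ)) := rfl

theorem smulLeftCLM_ofReal_apply (l : F →L[ℝ] ℝ) (φ : 𝓢(F, ℂ)) (x : F) :
    SchwartzMap.smulLeftCLM ℂ (fun x => (l x : ℂ)) φ x = (l x : ℂ) * φ x := by
  rw [SchwartzMap.smulLeftCLM_apply_apply (hasTemperateGrowth_ofReal l), smul_eq_mul]

theorem lineDeriv_smulLeftCLM (l : F →L[ℝ] ℝ) (w : F) (φ : 𝓢(F, ℂ)) :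
    ∂_{w} (SchwartzMap.smulLeftCLM ℂ (fun x => (l x : ℂ)) φ) =
      SchwartzMap.smulLeftCLM ℂ (fun x => (l x : ℂ)) (∂_{w} φ) + (l w : ℂ) • φ := by
  ext x
  rw [add_apply, smul_apply, smulLeftCLM_ofReal_apply, SchwartzMap.lineDerivOp_apply_eq_fderiv,
    SchwartzMap.lineDerivOp_apply_eq_fderiv]
  have hfun : (SchwartzMap.smulLeftCLM ℂ (fun x => (l x : ℂ)) φ : F → ℂ) =
      fun y => (Complex.ofRealCLM ∘L l) y * φ y := by
    ext y; exact smulLeftCLM_ofReal_apply l φ y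
  rw [hfun, fderiv_fun_mul (ContinuousLinearMap.differentiableAt _) φ.differentiableAt,
    ContinuousLinearMap.fderiv]
  simp [mul_comm]

theorem mulOp_mulOp (l m : F →L[ℝ] ℝ) : mulOp l * mulOp m = mulOp m * mulOp l := by
  ext f φ
  change f _ = f _
  congr 1
  ext x
  change SchwartzMap.smulLeftCLM ℂ (fun x => (m x : ℂ))
    (SchwartzMap.smulLeftCLM ℂ (fun x => (l x : ℂ)) φ) x =
    SchwartzMap.smulLeftCLM ℂ (fun x => (l x : ℂ))
      (SchwartzMap.smulLeftCLM ℂ (fun x => (m x : ℂ)) φ) x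
  simp only [smulLeftCLM_ofReal_apply]
  ring

theorem lineDeriv_comm (v w : F) (φ : 𝓢(F, ℂ)) : ∂_{v} (∂_{w} φ) = ∂_{w} (∂_{v} φ) := by
  have h : ∀ (v w : F) (x : F), (∂_{v} (∂_{w} φ)) x = fderiv ℝ (fderiv ℝ φ) x v w := by
    intro v w x
    rw [SchwartzMap.lineDerivOp_apply_eq_fderiv]
    have hfun : (∂_{w} φ : 𝓢(F, ℂ)) = fun y => fderiv ℝ φ y w := by
      ext y; exact SchwartzMap.lineDerivOp_apply_eq_fderiv _ _ _
    have hd : DifferentiableAt ℝ (fderiv ℝ φ) x :=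
      ((φ.smooth 2).fderiv_right (m := 1) (by norm_num)).differentiable (by norm_num) x
    rw [hfun, fderiv_clm_apply hd (differentiableAt_const w)]
    simp
  ext x
  rw [h, h]
  exact ((φ.smooth 2).contDiffAt.isSymmSndFDerivAt (by simp)) v w

theorem derivOp_derivOp (v w : F) : derivOp v * derivOp w = derivOp w * derivOp v := by
  ext f φ
  change f _ = f _
  congr 1
  have h : ∀ (u : F) (ψ : 𝓢(F, ℂ)), ∂_{u} (-ψ) = -(∂_{u} ψ) := fun u ψ =>
    map_neg (lineDerivOpCLM ℂ 𝓢(F, ℂ) u) ψ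
  change -(∂_{w} (-(∂_{v} φ))) = -(∂_{v} (-(∂_{w} φ)))
  rw [h, h, lineDeriv_comm]

theorem derivOp_mulOp (l : F →L[ℝ] ℝ) (w : F) :
    derivOp w * mulOp l = mulOp l * derivOp w + (l w : ℂ) • 1 := by
  ext f φ
  change f (SchwartzMap.smulLeftCLM ℂ (fun x => (l x : ℂ)) (-(∂_{w} φ))) =
    f (-(∂_{w} (SchwartzMap.smulLeftCLM ℂ (fun x => (l x : ℂ)) φ))) + (l w : ℂ) • f φ
  rw [lineDeriv_smulLeftCLM, ← map_smul, ← map_add]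
  congr 1
  rw [map_neg, neg_add, add_assoc, neg_add_cancel, add_zero]

theorem ofReal_pow_hasTemperateGrowth (l : F →L[ℝ] ℝ) (K : ℕ) :
    (fun x : F => (l x : ℂ) ^ K).HasTemperateGrowth :=
  (hasTemperateGrowth_ofReal l).pow K

theorem mulOp_pow_apply (l : F →L[ℝ] ℝ) (K : ℕ) (f : 𝓢'(F, ℂ)) (φ : 𝓢(F, ℂ)) :
    (mulOp l ^ K) f φ = f (SchwartzMap.smulLeftCLM ℂ (fun x => (l x : ℂ) ^ K) φ) := by
  induction K generalizing φ with
  | zero => 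
    simp only [pow_zero]
    rw [SchwartzMap.smulLeftCLM_const, smul_apply, ContinuousLinearMap.id_apply, one_smul]
    rfl
  | succ K ih =>
    rw [pow_succ']
    change (mulOp l ^ K) f (SchwartzMap.smulLeftCLM ℂ (fun x => (l x : ℂ)) φ) = _
    rw [ih, SchwartzMap.smulLeftCLM_smulLeftCLM_apply (ofReal_pow_hasTemperateGrowth l K)
      (hasTemperateGrowth_ofReal l)]
    rfl

variable (F) in
/-- The distributions on which cutting off at hyperplanes to the order `K` has no effect. -/
def cutoffNull (K : ℕ) : Submodule ℂ 𝓢'(F, ℂ) where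
  carrier := {f | ∀ (l : F →L[ℝ] ℝ) (h : ℝ → ℂ),
    HasCompactSupport h → ContDiff ℝ ∞ h → ∀ φ : 𝓢(F, ℂ),
      Tendsto (fun ε : ℝ => f (SchwartzMap.smulLeftCLM ℂ
        (fun y => (ε : ℂ) ^ K * h (ε⁻¹ * l y)) φ)) (𝓝[>] 0) (𝓝 0)}
  zero_mem' := fun l h hc hh φ => tendsto_const_nhds
  add_mem' := fun {f g} hf hg l h hc hh φ => by
    have := (hf l h hc hh φ).add (hg l h hc hh φ)
    rwa [add_zero] at this
  smul_mem' := fun c f hf l h hc hh φ => by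
    have := (hf l h hc hh φ).const_smul c
    rwa [smul_zero] at this

theorem cutoff_hasTemperateGrowth (l : F →L[ℝ] ℝ) {h : ℝ → ℂ} (hc : HasCompactSupport h)
    (hh : ContDiff ℝ ∞ h) (ε : ℝ) (K : ℕ) :
    (fun y => (ε : ℂ) ^ K * h (ε⁻¹ * l y)).HasTemperateGrowth :=
  (Function.HasTemperateGrowth.const ((ε : ℂ) ^ K)).mul
    (contDiff_comp_clm_hasTemperateGrowth hc hh (ε⁻¹ • l))

/-- The factor `m` can be absorbed into the test function. Thus one exponent `K` serves `f` and all
its polynomial multiples, although their order as distributions is not controlled separately. -/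
theorem mulOp_mem_cutoffNull (K : ℕ) (m : F →L[ℝ] ℝ) (f : 𝓢'(F, ℂ)) (hf : f ∈ cutoffNull F K) :
    mulOp m f ∈ cutoffNull F K := by
  intro l h hc hh φ
  refine (hf l h hc hh (SchwartzMap.smulLeftCLM ℂ (fun x => (m x : ℂ)) φ)).congr fun ε => ?_
  rw [mulOp_apply]
  congr 1
  ext x
  rw [smulLeftCLM_ofReal_apply, SchwartzMap.smulLeftCLM_apply_apply
    (cutoff_hasTemperateGrowth l hc hh ε K), SchwartzMap.smulLeftCLM_apply_apply
    (cutoff_hasTemperateGrowth l hc hh ε K), smulLeftCLM_ofReal_apply]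
  simp only [smul_eq_mul]
  ring

/-- If `f` vanishes on compactly supported test functions with support away from a hyperplane,
then a power of the equation of the hyperplane annihilates it. -/
theorem mulOp_pow_apply_eq_zero (K : ℕ) (l : F →L[ℝ] ℝ) (f : 𝓢'(F, ℂ)) (hf : f ∈ cutoffNull F K)
    (φ : 𝓢(F, ℂ)) (hφ : ∀ ψ : 𝓢(F, ℂ), tsupport ψ ⊆ tsupport φ → (∀ x ∈ tsupport ψ, l x ≠ 0) →
      f ψ = 0) : (mulOp l ^ K) f φ = 0 := by
  rw [mulOp_pow_apply]
  let χ : ContDiffBump (0 : ℝ) := default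
  -- With this profile the cutoff `ε ^ K * h (l / ε)` is `l ^ K * χ (l / ε)`. It differs from `l ^
  -- K` by a function vanishing near `l = 0`, which `f` does not see on `φ`; so the value at `l ^ K
  -- * φ` equals a quantity tending to zero.
  let h : ℝ → ℂ := fun t => (t : ℂ) ^ K * (χ t : ℂ)
  have hc : HasCompactSupport h :=
    HasCompactSupport.mul_left (χ.hasCompactSupport.comp_left (g := ((↑) : ℝ → ℂ)) rfl)
  have hh : ContDiff ℝ ∞ h :=
    (Complex.ofRealCLM.contDiff.pow K).mul (Complex.ofRealCLM.contDiff.comp χ.contDiff)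
  refine tendsto_nhds_unique (tendsto_const_nhds.congr' ?_) (hf l h hc hh φ)
  filter_upwards [self_mem_nhdsWithin] with ε (hε : 0 < ε)
  have htg := cutoff_hasTemperateGrowth l hc hh ε K
  have htg' : (fun x => (l x : ℂ) ^ K).HasTemperateGrowth := (hasTemperateGrowth_ofReal l).pow K
  have hg : ∀ x, ((fun x => (l x : ℂ) ^ K) - fun y => (ε : ℂ) ^ K * h (ε⁻¹ * l y)) x =
      (l x : ℂ) ^ K * (1 - (χ (ε⁻¹ * l x) : ℂ)) := by
    intro x
    simp only [Pi.sub_apply, h]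
    push_cast
    rw [mul_pow, inv_pow]
    have : (ε : ℂ) ^ K ≠ 0 := pow_ne_zero _ (by exact_mod_cast hε.ne')
    field_simp
  have h0 := hφ (SchwartzMap.smulLeftCLM ℂ
    ((fun x => (l x : ℂ) ^ K) - fun y => (ε : ℂ) ^ K * h (ε⁻¹ * l y)) φ)
    ((SchwartzMap.tsupport_smulLeftCLM_subset _ _).trans Set.inter_subset_left) (by
      intro x hx hlx
      have hx' := SchwartzMap.tsupport_smulLeftCLM_subset _ _ hx
      refine absurd hx'.2 (notMem_tsupport_iff_eventuallyEq.2 ?_)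
      have hcont : ContinuousAt (fun y => |ε⁻¹ * l y|) x := by fun_prop
      have hlt : |ε⁻¹ * l x| < χ.rIn := by rw [hlx]; simpa using χ.rIn_pos
      filter_upwards [hcont.eventually_lt_const hlt] with y hy
      rw [hg, χ.one_of_mem_closedBall (by
        simpa only [Metric.mem_closedBall, dist_zero_right, Real.norm_eq_abs] using hy.le)]
      simp)
  rw [SchwartzMap.smulLeftCLM_sub htg' htg] at h0
  change f (_ - _) = 0 at h0
  rw [map_sub, sub_eq_zero] at h0
  exact h0

/-- A distribution supported in a finite union of subspaces is annihilated by the products of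
sufficiently high powers of equations of these subspaces. -/
theorem exists_prod_mulOp_apply_eq_zero {G ι : Type*} [Fintype ι] (L : G → F →L[ℝ] ℝ)
    {ρ : MvPolynomial G ℂ →ₐ[ℂ] End ℂ 𝓢'(F, ℂ)} (hρ : ∀ v, ρ (MvPolynomial.X v) = mulOp (L v))
    (V : ι → Submodule ℝ F) (f : 𝓢'(F, ℂ)) (hf : dsupport f ⊆ ⋃ i, (V i : Set F)) :
    ∃ K : ℕ, ∀ v : ι → G, (∀ j, ∀ x ∈ V j, L (v j) x = 0) →
      ρ (∏ j, MvPolynomial.X (v j) ^ K) f = 0 := by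
  classical
  obtain ⟨K, hK⟩ := exists_tendsto_cutoff f
  refine ⟨K, fun v hv => ?_⟩
  have hfK : f ∈ cutoffNull F K := hK
  -- Only the subspaces that the support of `φ` may meet require a factor. The power of `L (v i)`
  -- reduces to test functions supported off the hyperplane `L (v i) = 0`, hence off `V i`, and
  -- removes `i` from the set.
  have key : ∀ (S : Finset ι) (φ : 𝓢(F, ℂ)), HasCompactSupport φ →
      (∀ j ∉ S, ∀ x ∈ tsupport φ, x ∉ V j) →
        ρ (∏ j ∈ S, MvPolynomial.X (v j) ^ K) f φ = 0 := by
    intro S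
    induction S using Finset.induction_on with
    | empty =>
      intro φ hφ hd
      rw [Finset.prod_empty, map_one]
      refine apply_eq_zero_of_disjoint_dsupport f φ hφ (Set.disjoint_left.2 fun x hx hxf => ?_)
      obtain ⟨i, hi⟩ := Set.mem_iUnion.1 (hf hxf)
      exact hd i (Finset.notMem_empty i) x hx hi
    | insert i S hi ih =>
      intro φ hφ hd
      rw [Finset.prod_insert hi, map_mul, map_pow, hρ]
      refine mulOp_pow_apply_eq_zero K (L (v i)) _ (algHom_apply_mem hρ _
        (fun w => mulOp_mem_cutoffNull K (L w)) _ f hfK) φ fun ψ hψ hl => ?_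
      refine ih ψ (hφ.mono' ((subset_tsupport _).trans hψ)) fun j hj x hx hxV => ?_
      by_cases hji : j = i
      · subst hji
        exact hl x hx (hv j x hxV)
      · exact hd j (by simp [hj, hji]) x (hψ hx) hxV
  ext φ
  refine apply_eq_zero_of_hasCompactSupport _ φ fun g hg hc => ?_
  exact key Finset.univ _ hc fun j hj => absurd (Finset.mem_univ j) hj

/-- A distribution annihilated by powers of the equations of a subspace is supported in it. -/
theorem dsupport_subset_of_pow_mulOp (V : Set F) (f : 𝓢'(F, ℂ))
    (h : ∀ x ∉ V, ∃ l : F →L[ℝ] ℝ, l x ≠ 0 ∧ ∃ k, (mulOp l ^ k) f = 0) : dsupport f ⊆ V := by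
  intro x hx
  by_contra hxV
  obtain ⟨l, hl, k, hk⟩ := h x hxV
  have hopen : IsOpen {y | l y ≠ 0} := isOpen_ne_fun l.continuous continuous_const
  obtain ⟨δ, hδ, hball⟩ := Metric.isOpen_iff.1 hopen x hl
  refine (notMem_dsupport_iff x).2 ⟨Metric.ball x δ, fun φ hφ => ?_, Metric.isOpen_ball,
    Metric.mem_ball_self hδ⟩ hx
  have hφc : HasCompactSupport φ := IsCompact.of_isClosed_subset (isCompact_closedBall x δ)
    (isClosed_tsupport _) (hφ.trans Metric.ball_subset_closedBall)
  -- Near `x` the function `l` has no zeros, so `φ` is divisible by `l ^ k`, and `l ^ k` kills `f`.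
  let ψ : F → ℂ := fun y => ((l y : ℂ) ^ k)⁻¹ * φ y
  have hψc : HasCompactSupport ψ := hφc.mul_left
  have hψ : ContDiff ℝ ∞ ψ := by
    refine contDiff_iff_contDiffAt.2 fun y => ?_
    by_cases hy : y ∈ tsupport ψ
    swap
    · exact contDiffAt_const.congr_of_eventuallyEq (notMem_tsupport_iff_eventuallyEq.1 hy)
    have hy' : y ∈ tsupport φ := closure_mono (Function.support_mul_subset_right _ _) hy
    have hly : l y ≠ 0 := hball (hφ hy')
    refine ContDiffAt.mul (ContDiffAt.inv ?_ ?_) (φ.smooth ⊤).contDiffAt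
    · exact ((Complex.ofRealCLM ∘L l).contDiff.pow k).contDiffAt
    · exact pow_ne_zero _ (by exact_mod_cast hly)
  have heq : φ = SchwartzMap.smulLeftCLM ℂ (fun y => (l y : ℂ) ^ k) (hψc.toSchwartzMap hψ) := by
    ext y
    rw [SchwartzMap.smulLeftCLM_apply_apply (ofReal_pow_hasTemperateGrowth l k),
      HasCompactSupport.toSchwartzMap_toFun, smul_eq_mul]
    by_cases hy : y ∈ tsupport φ
    · have hly : (l y : ℂ) ^ k ≠ 0 := pow_ne_zero _ (by exact_mod_cast (hball (hφ hy)))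
      simp only [ψ]
      field_simp
    · simp [ψ, image_eq_zero_of_notMem_tsupport hy]
  rw [heq, ← mulOp_pow_apply, hk]
  rfl

end Operators

/-! ### Hadamard's lemma and distributions killed by the equations of a subspace. -/

section Hadamard

variable {F : Type*} [NormedAddCommGroup F] [NormedSpace ℝ F] [FiniteDimensional ℝ F]

/-- The integral is the value at `0` of the convolution of the indicator of `(0, 1]` with `s ↦ χ s •
H (p, -s)`. The bump `χ` equals `1` on the relevant interval and supplies the compact support, so
smooth dependence of convolutions on a parameter applies. -/
theorem contDiff_intervalIntegral_param {W : Type*} [NormedAddCommGroup W] [NormedSpace ℝ W]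
    [CompleteSpace W] {H : F × ℝ → W} (hH : ContDiff ℝ ∞ H) :
    ContDiff ℝ ∞ fun p => ∫ t in (0 : ℝ)..1, H (p, t) := by
  let χ : ContDiffBump (0 : ℝ) := ⟨2, 3, by norm_num, by norm_num⟩
  let k : ℝ → ℝ := Set.indicator (Set.Ioc 0 1) fun _ => 1
  have hk : LocallyIntegrable k volume :=
    (IntegrableOn.integrable_indicator (by simp) measurableSet_Ioc).locallyIntegrable
  have hg : ContDiffOn ℝ ∞ (↿(fun (p : F) (s : ℝ) => χ s • H (p, -s))) (Set.univ ×ˢ Set.univ) := by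
    refine ContDiff.contDiffOn ?_
    exact (χ.contDiff.comp contDiff_snd).smul
      (hH.comp (contDiff_fst.prodMk contDiff_snd.neg))
  have h := contDiffOn_convolution_right_with_param_comp (μ := volume)
    (ContinuousLinearMap.lsmul ℝ ℝ (E := W)) (v := fun _ : F => (0 : ℝ)) contDiffOn_const
    isOpen_univ χ.hasCompactSupport
    (fun p x _ hx => by simp [image_eq_zero_of_notMem_tsupport hx]) hk hg
  rw [contDiffOn_univ] at h
  convert h using 2 with p
  rw [intervalIntegral.integral_of_le zero_le_one, convolution, ← integral_indicator measurableSet_Ioc]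
  congr 1
  ext t
  by_cases ht : t ∈ Set.Ioc (0 : ℝ) 1
  · have : χ (-t) = 1 := χ.one_of_mem_closedBall (by
      simp only [Metric.mem_closedBall, dist_zero_right, norm_neg, Real.norm_eq_abs]
      rw [abs_of_pos ht.1]
      exact ht.2.trans (by norm_num))
    simp [k, ht, this]
  · simp [k, ht]

/-- Hadamard's lemma, for a function vanishing on the range of a projection. -/
theorem exists_hadamard (φ : 𝓢(F, ℂ)) (π : F →L[ℝ] F) :
    ∃ Ψ : F → F →L[ℝ] ℂ, ContDiff ℝ ∞ Ψ ∧ ∀ x, φ x - φ (π x) = Ψ x (x - π x) := by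
  let c : F → ℝ → F := fun x t => π x + t • (x - π x)
  let H : F × ℝ → F →L[ℝ] ℂ := fun p => fderiv ℝ φ (c p.1 p.2)
  have hd : ContDiff ℝ ∞ (fderiv ℝ φ) := (φ.smooth ⊤).fderiv_right (by simp)
  have hc : ContDiff ℝ ∞ fun p : F × ℝ => c p.1 p.2 := by
    change ContDiff ℝ ∞ fun p : F × ℝ => π p.1 + p.2 • (p.1 - π p.1)
    fun_prop
  have hH : ContDiff ℝ ∞ H := hd.comp hc
  refine ⟨fun p => ∫ t in (0 : ℝ)..1, H (p, t), contDiff_intervalIntegral_param hH, fun x => ?_⟩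
  have hcont : Continuous fun t => H (x, t) := hH.continuous.comp (by fun_prop)
  rw [ContinuousLinearMap.intervalIntegral_apply (hcont.intervalIntegrable _ _)]
  have hderiv : ∀ t ∈ Set.uIcc (0 : ℝ) 1, HasDerivAt (fun t => φ (c x t)) (H (x, t) (x - π x)) t := by
    intro t _
    have h1 : HasDerivAt (c x) (x - π x) t := by
      have := ((hasDerivAt_id t).smul_const (x - π x)).const_add (π x)
      rw [one_smul] at this
      exact this
    exact (φ.differentiableAt.hasFDerivAt).comp_hasDerivAt t h1
  rw [intervalIntegral.integral_eq_sub_of_hasDerivAt hderiv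
    ((hcont.clm_apply continuous_const).intervalIntegrable _ _)]
  simp [c]

theorem exists_projection (V : Submodule ℝ F) : ∃ P : F →L[ℝ] V, ∀ x : V, P x = x := by
  obtain ⟨P, hP⟩ := V.subtype.exists_leftInverse_of_injective (by simp)
  exact ⟨LinearMap.toContinuousLinearMap P, fun x => congrArg (fun T => T x) hP⟩

theorem exists_bump_eq_one {φ : F → ℂ} (hφ : HasCompactSupport φ) :
    ∃ χ : ContDiffBump (0 : F), ∀ x, φ x ≠ 0 → χ x = 1 := by
  obtain ⟨R, hR, hball⟩ := hφ.isCompact.isBounded.subset_closedBall_lt 0 (0 : F)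
  refine ⟨⟨R, R + 1, hR, by linarith⟩, fun x hx => ContDiffBump.one_of_mem_closedBall _ ?_⟩
  exact hball (subset_tsupport _ hx)

/-- A distribution annihilated by all linear equations of a subspace `V` vanishes on the test
functions that are zero on `V`. -/
theorem apply_eq_zero_of_eqOn_zero (V : Submodule ℝ F) (f : 𝓢'(F, ℂ))
    (hf : ∀ l : F →L[ℝ] ℝ, (∀ x ∈ V, l x = 0) → mulOp l f = 0) (φ : 𝓢(F, ℂ))
    (hφ : ∀ x ∈ V, φ x = 0) : f φ = 0 := by
  refine apply_eq_zero_of_hasCompactSupport f φ fun g hg hc => ?_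
  have hφ' : ∀ x ∈ V, SchwartzMap.smulLeftCLM ℂ g φ x = 0 := fun x hx => by
    rw [SchwartzMap.smulLeftCLM_apply_apply hg, hφ x hx, smul_zero]
  generalize SchwartzMap.smulLeftCLM ℂ g φ = η at hc hφ'
  obtain ⟨P, hP⟩ := exists_projection V
  let π : F →L[ℝ] F := V.subtypeL ∘L P
  obtain ⟨Ψ, hΨ, hΨe⟩ := exists_hadamard η π
  obtain ⟨χ, hχ⟩ := exists_bump_eq_one hc
  let b := finBasis ℝ F
  -- The coordinates of `x - π x`. They vanish on `V`, and Hadamard's lemma writes `η` as a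
  -- combination of them with smooth coefficients, made compactly supported by `χ`.
  let l : Fin (finrank ℝ F) → F →L[ℝ] ℝ := fun i =>
    LinearMap.toContinuousLinearMap (b.coord i) ∘L (ContinuousLinearMap.id ℝ F - π)
  have hl : ∀ i, mulOp (l i) f = 0 := fun i => hf (l i) fun x hx => by
    have : P x = ⟨x, hx⟩ := hP ⟨x, hx⟩
    simp [l, π, this]
  have hcs : ∀ i, HasCompactSupport fun x => (χ x : ℂ) * Ψ x (b i) := fun i =>
    (χ.hasCompactSupport.comp_left (g := ((↑) : ℝ → ℂ)) rfl).mul_right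
  have hsm : ∀ i, ContDiff ℝ ∞ fun x => (χ x : ℂ) * Ψ x (b i) := fun i =>
    (Complex.ofRealCLM.contDiff.comp χ.contDiff).mul (hΨ.clm_apply contDiff_const)
  have heq : η = ∑ i, SchwartzMap.smulLeftCLM ℂ (fun x => (l i x : ℂ))
      ((hcs i).toSchwartzMap (hsm i)) := by
    ext x
    rw [sum_apply]
    simp only [smulLeftCLM_ofReal_apply, HasCompactSupport.toSchwartzMap_toFun]
    have h1 : η x = Ψ x (x - π x) := by
      rw [← hΨe, hφ' (π x) (P x).2, sub_zero]
    have h2 : η x = (χ x : ℂ) * η x := by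
      by_cases hx : η x = 0
      · simp [hx]
      · simp [hχ x hx]
    have h3 : Ψ x (x - π x) = ∑ i, (l i x : ℂ) * Ψ x (b i) := by
      conv_lhs => rw [← b.sum_repr (x - π x)]
      rw [map_sum]
      refine Finset.sum_congr rfl fun i _ => ?_
      rw [map_smul, Complex.real_smul]
      rfl
    rw [h2, h1, h3, Finset.mul_sum]
    refine Finset.sum_congr rfl fun i _ => by ring
  rw [heq, map_sum]
  refine Finset.sum_eq_zero fun i _ => ?_
  rw [← mulOp_apply, hl]
  rfl

end Hadamard

/-! ### Invertibility of the Fourier transform and its exchange of derivatives and multiplications.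
-/

section FourierInverse

variable {F : Type*} [NormedAddCommGroup F] [NormedSpace ℝ F] [FiniteDimensional ℝ F]
  [MeasurableSpace F] [BorelSpace F]

/-- The Fourier transform of Schwartz functions is invertible. -/
theorem exists_fourierS_inverse (B : LinearMap.BilinForm ℝ F) (hB : B.Nondegenerate) :
    ∃ S : 𝓢(F, ℂ) →L[ℂ] 𝓢(F, ℂ), (∀ φ, S (fourierS B hB φ) = φ) ∧
      ∀ φ, fourierS B hB (S φ) = φ := by
  obtain ⟨A, hA⟩ := exists_adj B hB
  set c : ℝ := Real.sqrt |(LinearMap.BilinForm.toMatrix (finBasis ℝ F) B).det| with hc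
  have hc0 : (c : ℂ) ≠ 0 := by
    have hdet := (LinearMap.BilinForm.nondegenerate_iff_det_ne_zero (finBasis ℝ F)).1 hB
    exact_mod_cast (Real.sqrt_pos.2 (abs_pos.2 hdet)).ne'
  have hvol : (volume : Measure (EuclideanSpace ℝ (Fin (finrank ℝ F)))) =
      (finBasis ℝ F).addHaar.map (toEuclid F) := by
    rw [Basis.map_addHaar, ← (EuclideanSpace.basisFun (Fin (finrank ℝ F)) ℝ).addHaar_eq_volume]
    congr 1
    ext1 i
    simp [toEuclid]
  let pre : 𝓢(F, ℂ) →L[ℂ] 𝓢(EuclideanSpace ℝ (Fin (finrank ℝ F)), ℂ) :=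
    SchwartzMap.compCLMOfContinuousLinearEquiv ℂ (toEuclid F).symm
  let pre' : 𝓢(EuclideanSpace ℝ (Fin (finrank ℝ F)), ℂ) →L[ℂ] 𝓢(F, ℂ) :=
    SchwartzMap.compCLMOfContinuousLinearEquiv ℂ (toEuclid F)
  let post : 𝓢(EuclideanSpace ℝ (Fin (finrank ℝ F)), ℂ) →L[ℂ] 𝓢(F, ℂ) :=
    SchwartzMap.compCLMOfContinuousLinearEquiv ℂ A
  let post' : 𝓢(F, ℂ) →L[ℂ] 𝓢(EuclideanSpace ℝ (Fin (finrank ℝ F)), ℂ) :=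
    SchwartzMap.compCLMOfContinuousLinearEquiv ℂ A.symm
  -- The map `fourierS` comes from an existence statement, so its factorization through the
  -- Euclidean transform is recovered from the integral formula.
  have hT : ∀ φ, fourierS B hB φ = (c : ℂ) • post (𝓕 (pre φ)) := by
    intro φ
    ext x
    have h0 : volumeOf B = ENNReal.ofReal c • (finBasis ℝ F).addHaar := rfl
    rw [fourierS_apply, h0, integral_smul_measure, ENNReal.toReal_ofReal (Real.sqrt_nonneg _)]
    simp only [smul_apply, smul_eq_mul, Complex.real_smul, post,
      SchwartzMap.compCLMOfContinuousLinearEquiv_apply,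
      Function.comp_apply, SchwartzMap.fourier_coe, Real.fourier_eq', pre]
    congr 1
    rw [hvol]
    refine Eq.symm (((toEuclid F).toHomeomorph.measurableEmbedding.integral_map _).trans ?_)
    congr 1
    ext y
    simp only [ContinuousLinearEquiv.coe_toHomeomorph, hA, ContinuousLinearEquiv.symm_apply_apply]
    rw [mul_comm]
    congr 2
    push_cast
    ring
  refine ⟨(c : ℂ)⁻¹ • (pre' ∘L (fourierInvCLM ℂ
    𝓢(EuclideanSpace ℝ (Fin (finrank ℝ F)), ℂ)) ∘L post'), fun φ => ?_, fun φ => ?_⟩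
  · have h1 : ∀ ψ, post' (post ψ) = ψ := fun ψ => by ext z; simp [post, post']
    have h2 : ∀ ψ, pre' (pre ψ) = ψ := fun ψ => by ext z; simp [pre, pre']
    rw [hT, map_smul]
    simp only [smul_apply, ContinuousLinearMap.comp_apply, h1, fourierInvCLM_apply,
      FourierPair.fourierInv_fourier_eq, h2]
    rw [smul_smul, mul_inv_cancel₀ hc0, one_smul]
  · have h1 : ∀ ψ, post (post' ψ) = ψ := fun ψ => by ext z; simp [post, post']
    have h2 : ∀ ψ, pre (pre' ψ) = ψ := fun ψ => by ext z; simp [pre, pre']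
    simp only [smul_apply, ContinuousLinearMap.comp_apply, map_smul, hT, h2, fourierInvCLM_apply,
      fourier_smul, FourierInvPair.fourier_fourierInv_eq, h1]
    rw [smul_smul, mul_inv_cancel₀ hc0, one_smul]

theorem fourierD_injective (B : LinearMap.BilinForm ℝ F) (hB : B.Nondegenerate) :
    Function.Injective (fourierD B hB) := by
  obtain ⟨S, -, hS⟩ := exists_fourierS_inverse B hB
  intro f g h
  ext φ
  have := congrArg (fun T : 𝓢'(F, ℂ) => T (S φ)) h
  simpa only [fourierD_apply, hS] using this

theorem fourierD_surjective (B : LinearMap.BilinForm ℝ F) (hB : B.Nondegenerate) :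
    Function.Surjective (fourierD B hB) := by
  obtain ⟨S, hS, -⟩ := exists_fourierS_inverse B hB
  intro f
  refine ⟨PointwiseConvergenceCLM.precomp ℂ S f, ?_⟩
  ext φ
  rw [fourierD_apply]
  change f (S (fourierS B hB φ)) = f φ
  rw [hS]

/-- The multiplication by the linear functional `B v`. -/
def formOp (B : LinearMap.BilinForm ℝ F) (v : F) : End ℂ 𝓢'(F, ℂ) :=
  mulOp (LinearMap.toContinuousLinearMap (B v))

theorem fourierD_derivOp (B : LinearMap.BilinForm ℝ F) (hB : B.Nondegenerate) (v : F)
    (f : 𝓢'(F, ℂ)) : fourierD B hB (derivOp v f) =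
      (2 * Real.pi * Complex.I : ℂ) • formOp B v (fourierD B hB f) :=
  fourierD_lineDeriv B hB f v

theorem fourierD_derivOp_pow (B : LinearMap.BilinForm ℝ F) (hB : B.Nondegenerate) (v : F) (k : ℕ)
    (f : 𝓢'(F, ℂ)) : fourierD B hB ((derivOp v ^ k) f) =
      (2 * Real.pi * Complex.I : ℂ) ^ k • (formOp B v ^ k) (fourierD B hB f) := by
  induction k with
  | zero => simp
  | succ k ih =>
    rw [pow_succ', pow_succ' (formOp B v)]
    change fourierD B hB (derivOp v ((derivOp v ^ k) f)) =
      _ • formOp B v ((formOp B v ^ k) (fourierD B hB f))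
    rw [fourierD_derivOp, ih, map_smul, smul_smul, ← pow_succ']

/-- The constant is a power of `2πi`; it stays unspecified because only the vanishing of the left
side is deduced from this. -/
theorem exists_fourierD_prod {ι : Type*} (B : LinearMap.BilinForm ℝ F) (hB : B.Nondegenerate)
    {ρX ρD : MvPolynomial F ℂ →ₐ[ℂ] End ℂ 𝓢'(F, ℂ)}
    (hρX : ∀ v, ρX (MvPolynomial.X v) = formOp B v)
    (hρD : ∀ v, ρD (MvPolynomial.X v) = derivOp v) (v : ι → F) (K : ℕ) (S : Finset ι)
    (f : 𝓢'(F, ℂ)) : ∃ c : ℂ, fourierD B hB (ρD (∏ j ∈ S, MvPolynomial.X (v j) ^ K) f) =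
      c • ρX (∏ j ∈ S, MvPolynomial.X (v j) ^ K) (fourierD B hB f) := by
  classical
  induction S using Finset.induction_on with
  | empty => exact ⟨1, by simp⟩
  | insert i S hi ih =>
    obtain ⟨c, hc⟩ := ih
    refine ⟨(2 * Real.pi * Complex.I : ℂ) ^ K * c, ?_⟩
    rw [Finset.prod_insert hi, map_mul, map_mul, map_pow, map_pow, hρX, hρD]
    change fourierD B hB ((derivOp (v i) ^ K) (ρD _ f)) =
      _ • (formOp B (v i) ^ K) (ρX _ (fourierD B hB f))
    rw [fourierD_derivOp_pow, hc, map_smul, smul_smul]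

theorem mem_genFun_iff (B : LinearMap.BilinForm ℝ F) (hB : B.Nondegenerate) (Z₁ Z₂ : Set F)
    (f : 𝓢'(F, ℂ)) : f ∈ genFun B hB Z₁ Z₂ ↔
      dsupport f ⊆ Z₁ ∧ dsupport (fourierD B hB f) ⊆ Z₂ := Iff.rfl

/-- Support in a finite union of isotropic subspaces, in terms of differential operators. -/
theorem exists_prod_apply_eq_zero_of_mem_genFun {ι : Type*} [Fintype ι]
    (B : LinearMap.BilinForm ℝ F) (hB : B.Nondegenerate)
    {ρX ρD : MvPolynomial F ℂ →ₐ[ℂ] End ℂ 𝓢'(F, ℂ)}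
    (hρX : ∀ v, ρX (MvPolynomial.X v) = formOp B v)
    (hρD : ∀ v, ρD (MvPolynomial.X v) = derivOp v) (V : ι → Submodule ℝ F)
    (hV : ∀ i, IsTotallyIsotropic B (V i)) (f : 𝓢'(F, ℂ))
    (hf : f ∈ genFun B hB (⋃ i, (V i : Set F)) (⋃ i, (V i : Set F))) :
    (∃ K : ℕ, ∀ v : ι → F, (∀ j, v j ∈ (V j : Set F)) →
      ρX (∏ j, MvPolynomial.X (v j) ^ K) f = 0) ∧
    ∃ K : ℕ, ∀ v : ι → F, (∀ j, v j ∈ (V j : Set F)) →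
      ρD (∏ j, MvPolynomial.X (v j) ^ K) f = 0 := by
  rw [mem_genFun_iff] at hf
  obtain ⟨K, hK⟩ := exists_prod_mulOp_apply_eq_zero
    (fun v => LinearMap.toContinuousLinearMap (B v)) hρX V f hf.1
  obtain ⟨K', hK'⟩ := exists_prod_mulOp_apply_eq_zero
    (fun v => LinearMap.toContinuousLinearMap (B v)) hρX V _ hf.2
  -- Isotropy is what makes `B (v j)` an equation of `V j` whenever `v j` lies in `V j`.
  refine ⟨⟨K, fun v hv => hK v fun j x hx => hV j _ (hv j) x hx⟩, K', fun v hv => ?_⟩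
  obtain ⟨c, hc⟩ := exists_fourierD_prod B hB hρX hρD v K' Finset.univ f
  rw [hK' v fun j x hx => hV j _ (hv j) x hx] at hc
  have h0 : c • (0 : 𝓢'(F, ℂ)) = 0 := by
    ext φ
    exact smul_zero c
  exact fourierD_injective B hB (hc.trans (h0.trans (map_zero _).symm))

theorem commute_formOp (B : LinearMap.BilinForm ℝ F) (v w : F) :
    formOp B v * formOp B w = formOp B w * formOp B v := mulOp_mulOp _ _

theorem derivOp_formOp (B : LinearMap.BilinForm ℝ F) (v w : F) :
    derivOp w * formOp B v = formOp B v * derivOp w + (B v w : ℂ) • 1 := derivOp_mulOp _ _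

theorem exists_algHom_formOp (B : LinearMap.BilinForm ℝ F) :
    ∃ ρ : MvPolynomial F ℂ →ₐ[ℂ] End ℂ 𝓢'(F, ℂ), ∀ v, ρ (MvPolynomial.X v) = formOp B v :=
  exists_algHom_of_commute _ (commute_formOp B)

variable (F) in
theorem exists_algHom_derivOp :
    ∃ ρ : MvPolynomial F ℂ →ₐ[ℂ] End ℂ 𝓢'(F, ℂ), ∀ v, ρ (MvPolynomial.X v) = derivOp v :=
  exists_algHom_of_commute _ derivOp_derivOp

end FourierInverse

/-! ### Lagrangian subspaces and linear functionals. -/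

section Lagrangian

variable {F : Type*} [NormedAddCommGroup F] [NormedSpace ℝ F] [FiniteDimensional ℝ F]

/-- A totally isotropic subspace of half the dimension is its own orthogonal complement. -/
theorem mem_of_forall_form_eq_zero {B : LinearMap.BilinForm ℝ F} (hs : B.IsSymm)
    (hB : B.Nondegenerate) {r : ℕ} (hdim : finrank ℝ F = 2 * r) {V : Submodule ℝ F}
    (hV : IsTotallyIsotropic B V) (hVr : finrank ℝ V = r) {w : F} (hw : ∀ v ∈ V, B w v = 0) :
    w ∈ V := by
  have hle : V ≤ LinearMap.BilinForm.orthogonal B V := fun x hx y hy => hV y hy x hx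
  have heq : V = LinearMap.BilinForm.orthogonal B V :=
    Submodule.eq_of_le_of_finrank_eq hle (by
      rw [LinearMap.BilinForm.finrank_orthogonal hB, hdim, hVr]; omega)
  rw [heq]
  intro v hv
  change B v w = 0
  rw [← hw v hv]
  exact hs.eq v w

theorem exists_form_eq {B : LinearMap.BilinForm ℝ F} (hB : B.Nondegenerate)
    (l : F →L[ℝ] ℝ) : ∃ w, l = LinearMap.toContinuousLinearMap (B w) := by
  obtain ⟨w, hw⟩ := (B.toDual hB).surjective (l : F →ₗ[ℝ] ℝ)
  refine ⟨w, ?_⟩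
  ext x
  exact (congrArg (fun k => k x) hw).symm

end Lagrangian

/-! ### The module of one Lagrangian subspace, described by local nilpotency. -/

section GenFun

variable {F : Type*} [NormedAddCommGroup F] [NormedSpace ℝ F] [FiniteDimensional ℝ F]
  [MeasurableSpace F] [BorelSpace F]

/-- Generalized functions with support and Fourier support in a Lagrangian subspace, in terms of
differential operators. -/
theorem mem_genFun_lagrangian_iff {B : LinearMap.BilinForm ℝ F} (hs : B.IsSymm)
    (hB : B.Nondegenerate) {r : ℕ} (hdim : finrank ℝ F = 2 * r) {V : Submodule ℝ F}
    (hV : IsTotallyIsotropic B V) (hVr : finrank ℝ V = r) (f : 𝓢'(F, ℂ)) :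
    f ∈ genFun B hB (V : Set F) (V : Set F) ↔
      (∀ v ∈ V, ∃ k, (formOp B v ^ k) f = 0) ∧ ∀ v ∈ V, ∃ k, (derivOp v ^ k) f = 0 := by
  constructor
  · intro hf
    obtain ⟨ρX, hρX⟩ := exists_algHom_formOp B
    obtain ⟨ρD, hρD⟩ := exists_algHom_derivOp F
    obtain ⟨⟨K, hK⟩, K', hK'⟩ := exists_prod_apply_eq_zero_of_mem_genFun (ι := Unit) B hB hρX hρD
      (fun _ => V) (fun _ => hV) f (by rwa [Set.iUnion_const])
    refine ⟨fun v hv => ⟨K, ?_⟩, fun v hv => ⟨K', ?_⟩⟩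
    · simpa [hρX] using hK (fun _ => v) (fun _ => hv)
    · simpa [hρD] using hK' (fun _ => v) (fun _ => hv)
  · rintro ⟨hX, hD⟩
    have hsep : ∀ x ∉ (V : Set F), ∃ v ∈ V, B v x ≠ 0 := by
      intro x hx
      by_contra! h
      exact hx (mem_of_forall_form_eq_zero hs hB hdim hV hVr fun v hv => by
        rw [← h v hv]; exact hs.eq x v)
    rw [mem_genFun_iff]
    refine ⟨dsupport_subset_of_pow_mulOp _ _ fun x hx => ?_,
      dsupport_subset_of_pow_mulOp _ _ fun x hx => ?_⟩
    · obtain ⟨v, hv, hvx⟩ := hsep x hx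
      exact ⟨LinearMap.toContinuousLinearMap (B v), hvx, hX v hv⟩
    · obtain ⟨v, hv, hvx⟩ := hsep x hx
      obtain ⟨k, hk⟩ := hD v hv
      refine ⟨LinearMap.toContinuousLinearMap (B v), hvx, k, ?_⟩
      have h := fourierD_derivOp_pow B hB v k f
      rw [hk, map_zero] at h
      exact (smul_eq_zero.1 h.symm).resolve_left (pow_ne_zero _ Complex.two_pi_I_ne_zero)

end GenFun

/-! ### Uniqueness of the vacuum vector up to scalars. -/

section Vacuum

variable {F : Type*} [NormedAddCommGroup F] [NormedSpace ℝ F] [FiniteDimensional ℝ F]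

section Extension

variable {V : Submodule ℝ F} (P : F →L[ℝ] V) (h : ContDiffBump (0 : F))

/-- The product of a function on a subspace with a bump function along a complement. -/
def bumpExt (b : V → ℂ) (x : F) : ℂ := b (P x) * (h (x - P x) : ℂ)

theorem bumpExt_hasCompactSupport {b : V → ℂ} (hb : HasCompactSupport b) :
    HasCompactSupport (bumpExt P h b) := by
  obtain ⟨R, hR⟩ := hb.isCompact.isBounded.subset_closedBall 0
  obtain ⟨R', hR'⟩ := h.hasCompactSupport.isCompact.isBounded.subset_closedBall 0
  refine HasCompactSupport.intro (isCompact_closedBall (0 : F) (R + R')) fun x hx => ?_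
  by_contra h0
  obtain ⟨h1, h2⟩ := mul_ne_zero_iff.1 h0
  have h3 := hR (subset_tsupport _ h1)
  have h4 := hR' (subset_tsupport _ (Complex.ofReal_ne_zero.1 h2))
  rw [mem_closedBall_zero_iff] at h3 h4 hx
  refine hx ?_
  calc ‖x‖ = ‖(P x : F) + (x - P x)‖ := by rw [add_sub_cancel]
    _ ≤ ‖(P x : F)‖ + ‖x - P x‖ := norm_add_le _ _
    _ ≤ R + R' := add_le_add h3 h4

theorem bumpExt_contDiff {b : V → ℂ} (hb : ContDiff ℝ ∞ b) : ContDiff ℝ ∞ (bumpExt P h b) := by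
  refine (hb.comp P.contDiff).mul (Complex.ofRealCLM.contDiff.comp (h.contDiff.comp ?_))
  exact contDiff_id.sub (V.subtypeL.contDiff.comp P.contDiff)

theorem bumpExt_coe (hP : ∀ x : V, P x = x) (b : V → ℂ) (x : V) : bumpExt P h b x = b x := by
  have : h (0 : F) = 1 := h.one_of_mem_closedBall (by simp [h.rIn_pos.le])
  simp [bumpExt, hP, this]

end Extension

variable [MeasurableSpace F] [BorelSpace F]

/-- Fubini for a product function with respect to a projection. -/
theorem integral_mul_projection_eq_zero (B : LinearMap.BilinForm ℝ F) {V : Submodule ℝ F}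
    (P : F →L[ℝ] V) (hP : ∀ x : V, P x = x) (b : V → ℂ) (k : F → ℂ)
    (hb : ∫ x, b x ∂(Measure.addHaar : Measure V) = 0) :
    ∫ y, b (P y) * k (y - P y) ∂(volumeOf B) = 0 := by
  let K : Submodule ℝ F := LinearMap.ker (P : F →ₗ[ℝ] V)
  have hc : IsCompl V K := LinearMap.isCompl_of_proj (f := (P : F →ₗ[ℝ] V)) hP
  let e : (V × K) ≃L[ℝ] F := (V.prodEquivOfIsCompl K hc).toContinuousLinearEquiv
  have he : ∀ p, e p = (p.1 : F) + p.2 := fun p => rfl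
  let μ : Measure (V × K) := (Measure.addHaar : Measure V).prod (Measure.addHaar : Measure K)
  have : (μ.map e).IsAddHaarMeasure := e.isAddHaarMeasure_map μ
  have h1 := Measure.isAddLeftInvariant_eq_smul (finBasis ℝ F).addHaar (μ.map e)
  have h2 : ∫ y, b (P y) * k (y - P y) ∂(μ.map e) = 0 := by
    have h3 := e.toHomeomorph.measurableEmbedding.integral_map (μ := μ)
      (fun y => b (P y) * k (y - P y))
    refine h3.trans ?_
    have h4 : ∀ p : V × K, P (e p) = p.1 := fun p => by
      have : P (p.2 : F) = 0 := p.2.2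
      rw [he, map_add, hP, this, add_zero]
    have h5 : ∀ p : V × K, b (P (e.toHomeomorph p)) *
        k (e.toHomeomorph p - P (e.toHomeomorph p)) = b p.1 * (fun z : K => k z) p.2 := fun p => by
      change b (P (e p)) * k (e p - P (e p)) = _
      rw [h4, he, add_sub_cancel_left]
    simp only [h5]
    -- The product formula holds without integrability, so no assumption on `k` is needed.
    refine (integral_prod_mul b (fun z : K => k z)).trans ?_
    rw [hb, zero_mul]
  rw [volumeOf, integral_smul_measure, h1, integral_smul_nnreal_measure, h2, smul_zero, smul_zero]

/-- The Fourier transform of a product function whose integral over the isotropic subspace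
vanishes. -/
theorem fourierS_bumpExt_eq_zero (B : LinearMap.BilinForm ℝ F) (hB : B.Nondegenerate)
    {V : Submodule ℝ F} (hV : IsTotallyIsotropic B V) (P : F →L[ℝ] V) (hP : ∀ x : V, P x = x)
    (h : ContDiffBump (0 : F)) (b : V → ℂ) (hb : ∫ x, b x ∂(Measure.addHaar : Measure V) = 0)
    (φ : 𝓢(F, ℂ)) (hφ : ∀ x, φ x = bumpExt P h b x) (v : F) (hv : v ∈ V) :
    fourierS B hB φ v = 0 := by
  rw [fourierS_apply, ← integral_mul_projection_eq_zero B P hP b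
    (fun z => (h z : ℂ) * Complex.exp (-(2 * Real.pi * Complex.I * B v z))) hb]
  congr 1
  ext y
  -- By isotropy the phase at `v` in `V` ignores the component of `y` along `V`, so the integrand
  -- splits as a product and the integral of `b` factors out.
  have : B v (y - P y) = B v y := by rw [map_sub, hV v hv _ (P y).2, sub_zero]
  rw [hφ, bumpExt, this, mul_assoc]

/-- A vacuum distribution kills test functions whose Fourier transform vanishes on `V`. -/
theorem apply_eq_zero_of_fourierS {B : LinearMap.BilinForm ℝ F} (hs : B.IsSymm)
    (hB : B.Nondegenerate) {r : ℕ} (hdim : finrank ℝ F = 2 * r) {V : Submodule ℝ F}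
    (hV : IsTotallyIsotropic B V) (hVr : finrank ℝ V = r) (f : 𝓢'(F, ℂ))
    (hf : ∀ v ∈ V, derivOp v f = 0) (φ : 𝓢(F, ℂ)) (hφ : ∀ v ∈ V, fourierS B hB φ v = 0) :
    f φ = 0 := by
  obtain ⟨S, -, hS⟩ := exists_fourierS_inverse B hB
  have hl : ∀ l : F →L[ℝ] ℝ, (∀ x ∈ V, l x = 0) →
      ∃ v ∈ V, l = LinearMap.toContinuousLinearMap (B v) := by
    intro l hl
    obtain ⟨v, rfl⟩ := exists_form_eq hB l
    exact ⟨v, mem_of_forall_form_eq_zero hs hB hdim hV hVr hl, rfl⟩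
  -- On the Fourier side the condition `derivOp v f = 0` says that `g` is killed by all equations of
  -- `V`, so `g` sees only the restriction of a test function to `V`.
  obtain ⟨g, rfl⟩ : ∃ g, fourierD B hB g = f := fourierD_surjective B hB f
  rw [fourierD_apply]
  refine apply_eq_zero_of_eqOn_zero V g (fun l hlV => ?_) _ hφ
  obtain ⟨v, hv, rfl⟩ := hl l hlV
  have h1 : ∀ y, B v y = B y v := fun y => hs.eq v y
  have h2 := fourierD_smul B hB g v
  have h3 : TemperedDistribution.smulLeftCLM ℂ (fun y => (B y v : ℂ)) g = formOp B v g := by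
    simp only [← h1]
    rfl
  have h4 : (∂_{v} (fourierD B hB g)) = 0 := hf v hv
  rw [h3, h4, neg_zero] at h2
  have h5 : fourierD B hB (formOp B v g) = 0 := by
    ext φ
    have h6 := congrArg (fun T : 𝓢'(F, ℂ) => T φ) h2
    exact (mul_eq_zero.1 h6).resolve_left Complex.two_pi_I_ne_zero
  exact fourierD_injective B hB (h5.trans (map_zero _).symm)

/-- The vacuum space is at most one dimensional: it is detected by one test function. -/
theorem exists_vacuum_test {B : LinearMap.BilinForm ℝ F} (hs : B.IsSymm)
    (hB : B.Nondegenerate) {r : ℕ} (hdim : finrank ℝ F = 2 * r) {V : Submodule ℝ F}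
    (hV : IsTotallyIsotropic B V) (hVr : finrank ℝ V = r) :
    ∃ φ₀ : 𝓢(F, ℂ), ∀ f : 𝓢'(F, ℂ), (∀ v ∈ V, formOp B v f = 0) → (∀ v ∈ V, derivOp v f = 0) →
      f φ₀ = 0 → f = 0 := by
  obtain ⟨P, hP⟩ := exists_projection V
  let h : ContDiffBump (0 : F) := default
  let a : ContDiffBump (0 : V) := default
  have hac : HasCompactSupport fun x => (a x : ℂ) :=
    a.hasCompactSupport.comp_left (g := ((↑) : ℝ → ℂ)) rfl
  have has : ContDiff ℝ ∞ fun x => (a x : ℂ) := Complex.ofRealCLM.contDiff.comp a.contDiff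
  have haI : ∫ x, (a x : ℂ) ∂(Measure.addHaar : Measure V) ≠ 0 := by
    rw [integral_complex_ofReal]
    exact Complex.ofReal_ne_zero.2 a.integral_pos.ne'
  let φ₀ : 𝓢(F, ℂ) := (bumpExt_hasCompactSupport P h hac).toSchwartzMap (bumpExt_contDiff P h has)
  refine ⟨φ₀, fun f hX hD h0 => ?_⟩
  ext φ
  change f φ = 0
  refine apply_eq_zero_of_hasCompactSupport f φ fun g hg hc => ?_
  generalize SchwartzMap.smulLeftCLM ℂ g φ = η at hc
  have hbc : HasCompactSupport fun x : V => η x :=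
    hc.comp_isClosedEmbedding V.closed_of_finiteDimensional.isClosedEmbedding_subtypeVal
  have hbs : ContDiff ℝ ∞ fun x : V => η x := (η.smooth ⊤).comp V.subtypeL.contDiff
  let η₁ : 𝓢(F, ℂ) := (bumpExt_hasCompactSupport P h hbc).toSchwartzMap (bumpExt_contDiff P h hbs)
  -- A vacuum depends only on `η` restricted to `V`, so `η` may be replaced by the product extension
  -- `η₁`. It also depends only on the Fourier transform restricted to `V`; the choice of `c` gives
  -- `η - c * a` integral zero over `V`, and so kills that restriction for `η₁ - c • φ₀`. Hence `f η
  -- = c * f φ₀`.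
  let c : ℂ := (∫ x : V, η x ∂(Measure.addHaar : Measure V)) /
    ∫ x, (a x : ℂ) ∂(Measure.addHaar : Measure V)
  have h1 : f (η - η₁) = 0 := by
    refine apply_eq_zero_of_eqOn_zero V f (fun l hl => ?_) _ fun x hx => ?_
    · obtain ⟨v, rfl⟩ := exists_form_eq hB l
      exact hX v (mem_of_forall_form_eq_zero hs hB hdim hV hVr hl)
    · have := bumpExt_coe P h hP (fun x : V => η x) ⟨x, hx⟩
      change η x - bumpExt P h (fun x : V => η x) x = 0
      rw [show bumpExt P h (fun x : V => η x) x = η x from this, sub_self]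
  have h2 : f (η₁ - c • φ₀) = 0 := by
    refine apply_eq_zero_of_fourierS hs hB hdim hV hVr f hD _ ?_
    refine fourierS_bumpExt_eq_zero B hB hV P hP h (fun x => η x - c * (a x : ℂ)) ?_ _ fun x => ?_
    · rw [integral_sub, integral_const_mul, div_mul_cancel₀ _ haI, sub_self]
      · exact hbs.continuous.integrable_of_hasCompactSupport hbc
      · exact (has.continuous.integrable_of_hasCompactSupport hac).const_mul c
    · change bumpExt P h (fun x : V => η x) x - c * bumpExt P h (fun x => (a x : ℂ)) x = _
      simp only [bumpExt]
      ring
  rw [map_sub, map_smul, h0, smul_zero, sub_zero] at h2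
  rw [map_sub, h2, sub_zero] at h1
  exact h1

end Vacuum

/-! ### Sums of modules that are simple or zero. -/

section Semisimple

variable {R E ι : Type*} [Ring R] [AddCommGroup E] [Module R E] [Finite ι]

/-- Structure of a finite sum of submodules each of which is simple or zero. -/
theorem semisimple_of_eq_iSup (S : ι → Submodule R E)
    (hS : ∀ i, ∀ N ≤ S i, N ≠ ⊥ → N = S i) (M : Submodule R E) (hM : M = ⨆ i, S i) :
    IsSemisimpleModule R M ∧ IsFiniteLength R M ∧
    ∀ N N' : Submodule R M, N ≤ N' → IsSimpleModule R (N' ⧸ N.submoduleOf N') →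
      ∃ i, Nonempty ((N' ⧸ N.submoduleOf N') ≃ₗ[R] S i) := by
  have hcases : ∀ i, IsSimpleModule R (S i) ∨ Subsingleton (S i) := by
    intro i
    by_cases h : S i = ⊥
    · right
      rw [h]
      infer_instance
    · left
      rw [isSimpleModule_iff_isAtom]
      refine ⟨h, fun N hN => ?_⟩
      by_contra h0
      exact hN.ne (hS i N hN.le h0)
  have hss : ∀ i, IsSemisimpleModule R (S i) := fun i => by
    rcases hcases i with h | h
    · infer_instance
    · exact (isSemisimpleModule_iff R _).2 ⟨fun x =>
        ⟨x, disjoint_iff.2 (Subsingleton.elim _ _), codisjoint_iff.2 (Subsingleton.elim _ _)⟩⟩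
  have hno : ∀ i, IsNoetherian R (S i) := fun i => by
    rcases hcases i with h | h <;> infer_instance
  have har : ∀ i, IsArtinian R (S i) := fun i => by
    rcases hcases i with h | h <;> infer_instance
  have hssM : IsSemisimpleModule R M := by
    have := isSemisimpleModule_biSup_of_isSemisimpleModule_submodule (s := Set.univ) (p := S)
      fun i _ => hss i
    rwa [iSup_univ, ← hM] at this
  have hnoM : IsNoetherian R M := by rw [hM]; infer_instance
  have harM : IsArtinian R M := by rw [hM]; infer_instance
  refine ⟨hssM, isFiniteLength_iff_isNoetherian_isArtinian.2 ⟨hnoM, harM⟩,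
    fun N N' _ hsimple => ?_⟩
  -- By semisimplicity the subquotient is realized as a simple submodule of `M`. Such a submodule
  -- embeds in one of the `S i`, where its nonzero image must be all of `S i`.
  obtain ⟨q, ⟨e⟩⟩ := IsSemisimpleModule.exists_submodule_linearEquiv_quotient (N.submoduleOf N')
  let e' : (q.map N'.subtype) ≃ₗ[R] q :=
    (Submodule.equivMapOfInjective N'.subtype N'.injective_subtype q).symm
  have : IsSimpleModule R (q.map N'.subtype) := IsSimpleModule.congr (e'.trans e)
  have htop : sSup (Set.range fun i => (S i).submoduleOf M) = ⊤ := by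
    rw [sSup_range, eq_top_iff]
    apply Submodule.map_le_map_iff_of_injective M.injective_subtype _ _ |>.1
    rw [Submodule.map_iSup, Submodule.map_top, Submodule.range_subtype, hM]
    refine iSup_mono fun i => ?_
    rw [Submodule.submoduleOf, Submodule.map_comap_subtype]
    exact le_inf (le_iSup S i) le_rfl
  obtain ⟨_, ⟨i, rfl⟩, T, hT, ⟨e₂⟩⟩ :=
    Submodule.le_linearEquiv_of_sSup_eq_top (q.map N'.subtype) _ htop
  let e₃ : T ≃ₗ[R] T.map M.subtype :=
    Submodule.equivMapOfInjective M.subtype M.injective_subtype T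
  have hne : Nontrivial (T.map M.subtype) :=
    have := IsSimpleModule.nontrivial R (q.map N'.subtype)
    (e₂.trans e₃).symm.toEquiv.nontrivial
  have heq : T.map M.subtype = S i := by
    refine hS i _ ?_ ((Submodule.nontrivial_iff_ne_bot).1 hne)
    exact (Submodule.map_mono hT).trans (Submodule.map_comap_le _ _)
  exact ⟨i, ⟨e.symm.trans (e'.symm.trans (e₂.trans (e₃.trans (LinearEquiv.ofEq _ _ heq))))⟩⟩

end Semisimple

/-! ### Simplicity of the module attached to one Lagrangian subspace. -/

section WeylModules

variable {F : Type*} [NormedAddCommGroup F] [NormedSpace ℝ F] [FiniteDimensional ℝ F]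

instance : IsScalarTower ℂ (Weyl F) 𝓢'(F, ℂ) := ⟨fun _ _ _ => rfl⟩

theorem mulOp_mem (N : Submodule (Weyl F) 𝓢'(F, ℂ)) (l : F →L[ℝ] ℝ) (f : 𝓢'(F, ℂ)) (hf : f ∈ N) :
    mulOp l f ∈ N :=
  N.smul_mem (show Weyl F from (⟨mulOp l, Algebra.subset_adjoin (Or.inl ⟨l, rfl⟩)⟩ : weylOps F)) hf

theorem derivOp_mem (N : Submodule (Weyl F) 𝓢'(F, ℂ)) (v : F) (f : 𝓢'(F, ℂ)) (hf : f ∈ N) :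
    derivOp v f ∈ N :=
  N.smul_mem (show Weyl F from (⟨derivOp v, Algebra.subset_adjoin (Or.inr ⟨v, rfl⟩)⟩ : weylOps F))
    hf

theorem derivOp_eq_zero_of_mem_span (f : 𝓢'(F, ℂ)) {s : Set F} (h : ∀ v ∈ s, derivOp v f = 0)
    {v : F} (hv : v ∈ Submodule.span ℝ s) : derivOp v f = 0 := by
  have hfd : ∀ (v : F) (φ : 𝓢(F, ℂ)) (x : F), (∂_{v} φ) x = fderiv ℝ φ x v := fun v φ x =>
    SchwartzMap.lineDerivOp_apply_eq_fderiv _ _ _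
  induction hv using Submodule.span_induction with
  | mem v hv => exact h v hv
  | zero =>
    ext φ
    rw [derivOp_apply, show ∂_{(0 : F)} φ = 0 by ext x; simp, neg_zero, map_zero]
    rfl
  | add v w _ _ hv hw =>
    ext φ
    rw [derivOp_apply, show -(∂_{v + w} φ) = -(∂_{v} φ) + -(∂_{w} φ) by
      rw [← neg_add]; congr 1; ext x; simp [hfd], map_add, ← derivOp_apply, ← derivOp_apply, hv, hw]
    exact add_zero _
  | smul c v _ hv =>
    ext φ
    rw [derivOp_apply, show -(∂_{c • v} φ) = (c : ℂ) • -(∂_{v} φ) by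
      rw [smul_neg]; congr 1; ext x; simp [hfd], map_smul, ← derivOp_apply, hv]
    exact smul_zero _

theorem formOp_eq_zero_of_mem_span (B : LinearMap.BilinForm ℝ F) (f : 𝓢'(F, ℂ)) {s : Set F}
    (h : ∀ v ∈ s, formOp B v f = 0) {v : F} (hv : v ∈ Submodule.span ℝ s) : formOp B v f = 0 := by
  induction hv using Submodule.span_induction with
  | mem v hv => exact h v hv
  | zero =>
    ext φ
    rw [formOp, mulOp_apply, show SchwartzMap.smulLeftCLM ℂ (fun x =>
      ((LinearMap.toContinuousLinearMap (B (0 : F)) : F →L[ℝ] ℝ) x : ℂ)) φ = 0 by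
        ext x; simp only [smulLeftCLM_ofReal_apply]; simp, map_zero]
    rfl
  | add v w _ _ hv hw =>
    ext φ
    rw [formOp, mulOp_apply, show SchwartzMap.smulLeftCLM ℂ (fun x =>
      ((LinearMap.toContinuousLinearMap (B (v + w)) : F →L[ℝ] ℝ) x : ℂ)) φ =
      SchwartzMap.smulLeftCLM ℂ (fun x =>
        ((LinearMap.toContinuousLinearMap (B v) : F →L[ℝ] ℝ) x : ℂ)) φ +
      SchwartzMap.smulLeftCLM ℂ (fun x =>
        ((LinearMap.toContinuousLinearMap (B w) : F →L[ℝ] ℝ) x : ℂ)) φ by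
        ext x; rw [add_apply]; simp only [smulLeftCLM_ofReal_apply]; simp; ring,
      map_add, ← mulOp_apply, ← mulOp_apply]
    change formOp B v f φ + formOp B w f φ = 0
    rw [hv, hw]
    exact add_zero _
  | smul c v _ hv =>
    ext φ
    rw [formOp, mulOp_apply, show SchwartzMap.smulLeftCLM ℂ (fun x =>
      ((LinearMap.toContinuousLinearMap (B (c • v)) : F →L[ℝ] ℝ) x : ℂ)) φ =
      (c : ℂ) • SchwartzMap.smulLeftCLM ℂ (fun x =>
        ((LinearMap.toContinuousLinearMap (B v) : F →L[ℝ] ℝ) x : ℂ)) φ by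
        ext x; rw [smul_apply]; simp only [smulLeftCLM_ofReal_apply]; simp; ring,
      map_smul, ← mulOp_apply]
    change (c : ℂ) • formOp B v f φ = 0
    rw [hv]
    exact smul_zero _

variable [MeasurableSpace F] [BorelSpace F]

theorem genFun_mono (B : LinearMap.BilinForm ℝ F) (hB : B.Nondegenerate) {Z₁ Z₂ Z₁' Z₂' : Set F}
    (h₁ : Z₁ ⊆ Z₁') (h₂ : Z₂ ⊆ Z₂') : genFun B hB Z₁ Z₂ ≤ genFun B hB Z₁' Z₂' :=
  fun _ hf => ⟨hf.1.trans h₁, hf.2.trans h₂⟩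

/-- The module attached to one Lagrangian subspace has no proper nonzero submodules. -/
theorem eq_genFun_of_le {B : LinearMap.BilinForm ℝ F} (hs : B.IsSymm)
    (hB : B.Nondegenerate) {r : ℕ} (hdim : finrank ℝ F = 2 * r) {V : Submodule ℝ F}
    (hV : IsTotallyIsotropic B V) (hVr : finrank ℝ V = r)
    (N : Submodule (Weyl F) 𝓢'(F, ℂ)) (hN : N ≤ genFun B hB (V : Set F) (V : Set F))
    (hN0 : N ≠ ⊥) : N = genFun B hB (V : Set F) (V : Set F) := by
  let v := finBasis ℝ V
  obtain ⟨P, hP⟩ := exists_projection V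
  -- Dual vectors, obtained by representing extended coordinate functionals of `V`. They need not
  -- span an isotropic subspace, because the creation operators are never required to commute with
  -- each other.
  have hw : ∀ j, ∃ w : F, ∀ i, B w (v i) = if i = j then 1 else 0 := by
    intro j
    obtain ⟨w, hw⟩ := exists_form_eq hB (LinearMap.toContinuousLinearMap (v.coord j) ∘L P)
    refine ⟨w, fun i => ?_⟩
    have := congrArg (fun T : F →L[ℝ] ℝ => T (v i)) hw
    refine this.symm.trans ?_
    simp [hP, Finsupp.single_apply]
  choose w hw using hw
  have hw' : ∀ i j, B (v i) (w j) = if i = j then 1 else 0 := fun i j => by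
    rw [← hw j i]; exact hs.eq _ _
  let ι := Fin (finrank ℝ V) ⊕ Fin (finrank ℝ V)
  let a : ι → End ℂ 𝓢'(F, ℂ) := Sum.elim (fun i => formOp B (v i)) fun i => derivOp (v i : F)
  -- The sign makes `[X_v, -D_w] = B v w`, so both kinds of pairs satisfy the same relation `a i * b
  -- i = b i * a i + 1`.
  let b : ι → End ℂ 𝓢'(F, ℂ) := Sum.elim (fun i => -derivOp (w i)) fun i => formOp B (w i)
  have hXD : ∀ x y : F, formOp B x * -derivOp y = -derivOp y * formOp B x + (B x y : ℂ) • 1 := by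
    intro x y
    rw [mul_neg, neg_mul, derivOp_formOp]
    abel
  have hiso : ∀ i j, B (v i) (v j) = 0 := fun i j => hV _ (v i).2 _ (v j).2
  have haa : ∀ i j, a i * a j = a j * a i := by
    rintro (i | i) (j | j)
    · exact commute_formOp B _ _
    · change formOp B (v i) * derivOp (v j : F) = derivOp (v j : F) * formOp B (v i)
      rw [derivOp_formOp, hiso]; simp
    · change derivOp (v i : F) * formOp B (v j) = formOp B (v j) * derivOp (v i : F)
      rw [derivOp_formOp, hiso]; simp
    · exact derivOp_derivOp _ _
  have hab : ∀ i, a i * b i = b i * a i + 1 := by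
    rintro (i | i)
    · change formOp B (v i) * -derivOp (w i) = -derivOp (w i) * formOp B (v i) + 1
      rw [hXD, hw']; simp
    · change derivOp (v i : F) * formOp B (w i) = formOp B (w i) * derivOp (v i : F) + 1
      rw [derivOp_formOp, hw]; simp
  have hab' : ∀ i j, i ≠ j → a i * b j = b j * a i := by
    rintro (i | i) (j | j) hij
    · change formOp B (v i) * -derivOp (w j) = -derivOp (w j) * formOp B (v i)
      rw [hXD, hw', if_neg (fun h => hij (by rw [h]))]; simp
    · exact commute_formOp B _ _
    · change derivOp (v i : F) * -derivOp (w j) = -derivOp (w j) * derivOp (v i : F)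
      rw [mul_neg, neg_mul, derivOp_derivOp]
    · change derivOp (v i : F) * formOp B (w j) = formOp B (w j) * derivOp (v i : F)
      rw [derivOp_formOp, hw, if_neg (fun h => hij (by rw [h]))]; simp
  have ha : ∀ (N : Submodule (Weyl F) 𝓢'(F, ℂ)) i, ∀ x ∈ N, a i x ∈ N := by
    rintro N (i | i) x hx
    · exact mulOp_mem N _ x hx
    · exact derivOp_mem N _ x hx
  have hb : ∀ (N : Submodule (Weyl F) 𝓢'(F, ℂ)) i, ∀ x ∈ N, b i x ∈ N := by
    rintro N (i | i) x hx
    · exact N.neg_mem (derivOp_mem N _ x hx)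
    · exact mulOp_mem N _ x hx
  have hnil : ∀ i, ∀ x ∈ genFun B hB (V : Set F) (V : Set F), ∃ n, (a i ^ n) x = 0 := by
    rintro (i | i) x hx
    · exact ((mem_genFun_lagrangian_iff hs hB hdim hV hVr x).1 hx).1 _ (v i).2
    · exact ((mem_genFun_lagrangian_iff hs hB hdim hV hVr x).1 hx).2 _ (v i).2
  have hspan : ∀ x ∈ V, x ∈ Submodule.span ℝ (Set.range fun i => (v i : F)) := by
    intro x hx
    have h1 : (⟨x, hx⟩ : V) ∈ Submodule.span ℝ (Set.range v) := by rw [v.span_eq]; trivial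
    have h2 := Submodule.mem_map_of_mem (f := V.subtype) h1
    rwa [Submodule.map_span, ← Set.range_comp] at h2
  have hvac : ∀ f : 𝓢'(F, ℂ), (∀ i, a i f = 0) →
      (∀ x ∈ V, formOp B x f = 0) ∧ ∀ x ∈ V, derivOp x f = 0 := by
    intro f hf
    refine ⟨fun x hx => formOp_eq_zero_of_mem_span B f ?_ (hspan x hx),
      fun x hx => derivOp_eq_zero_of_mem_span f ?_ (hspan x hx)⟩
    · rintro _ ⟨i, rfl⟩
      exact hf (Sum.inl i)
    · rintro _ ⟨i, rfl⟩
      exact hf (Sum.inr i)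
  refine le_antisymm hN ?_
  obtain ⟨φ₀, hφ₀⟩ := exists_vacuum_test hs hB hdim hV hVr
  obtain ⟨f, hfN, hf0, hf⟩ := exists_vacuum a haa (N.restrictScalars ℂ) (ha N)
    (fun i x hx => hnil i x (hN hx)) (fun h => hN0 ((Submodule.restrictScalars_eq_bot_iff ℂ (Weyl F) 𝓢'(F, ℂ)).1 h))
  have hfφ : f φ₀ ≠ 0 := fun h => hf0 (hφ₀ f (hvac f hf).1 (hvac f hf).2 h)
  refine mem_of_vacuum_mem a b haa hab hab'
    ((genFun B hB (V : Set F) (V : Set F)).restrictScalars ℂ) (N.restrictScalars ℂ)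
    (ha _) (hb _) (hb N) hnil fun g _ hg => ?_
  -- Any vacuum `g` is a multiple of the vacuum `f` found in `N`: the difference is a vacuum that
  -- vanishes on the detecting function `φ₀`.
  have hg' : ∀ i, a i (g - (g φ₀ / f φ₀) • f) = 0 := fun i => by
    rw [map_sub, map_smul, hf, hg]
    ext φ
    change (0 : ℂ) - (g φ₀ / f φ₀) • (0 : ℂ) = 0
    rw [smul_zero, sub_zero]
  have hz : g - (g φ₀ / f φ₀) • f = 0 := by
    refine hφ₀ _ (hvac _ hg').1 (hvac _ hg').2 ?_
    change g φ₀ - (g φ₀ / f φ₀) • f φ₀ = 0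
    rw [smul_eq_mul, div_mul_cancel₀ _ hfφ, sub_self]
  rw [sub_eq_zero.1 hz]
  exact (N.restrictScalars ℂ).smul_mem _ hfN

end WeylModules

end QuadSpace
end

/-! ### The module of the union as the sum of the modules of the `V i`. -/

theorem mainTheorem8 {F : Type*} [NormedAddCommGroup F] [NormedSpace ℝ F] [FiniteDimensional ℝ F]
    [MeasurableSpace F] [BorelSpace F] (B : LinearMap.BilinForm ℝ F) (hsymm : B.IsSymm)
    (hnd : B.Nondegenerate) (r : ℕ) (hdim : Module.finrank ℝ F = 2 * r)
    {s : ℕ} (V : Fin s → Submodule ℝ F) (hV : Function.Injective V)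
    (hiso : ∀ i, QuadSpace.IsTotallyIsotropic B (V i))
    (hVdim : ∀ i, Module.finrank ℝ (V i) = r)
    (M : Submodule (QuadSpace.Weyl F) 𝓢'(F, ℂ))
    (hM : M = QuadSpace.genFun B hnd (⋃ i, (V i : Set F)) (⋃ i, (V i : Set F))) :
    IsSemisimpleModule (QuadSpace.Weyl F) M ∧
    IsFiniteLength (QuadSpace.Weyl F) M ∧
    ∀ N N' : Submodule (QuadSpace.Weyl F) M, N ≤ N' →
      IsSimpleModule (QuadSpace.Weyl F) (N' ⧸ N.submoduleOf N') →
      ∃ i, Nonempty ((N' ⧸ N.submoduleOf N') ≃ₗ[QuadSpace.Weyl F]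
        QuadSpace.genFun B hnd (V i : Set F) (V i : Set F)) := by
  open QuadSpace in
  refine semisimple_of_eq_iSup (fun i => genFun B hnd (V i : Set F) (V i : Set F))
    (fun i N hN hN0 => eq_genFun_of_le hsymm hnd hdim (hiso i) (hVdim i) N hN hN0) M ?_
  open QuadSpace in
  refine le_antisymm ?_ (iSup_le fun i => ?_)
  · obtain ⟨ρX, hρX⟩ := exists_algHom_formOp B
    obtain ⟨ρD, hρD⟩ := exists_algHom_derivOp F
    refine le_of_separated (a := formOp B) (d := derivOp) (γ := fun v w => (B v w : ℂ))
      (fun v w => derivOp_formOp B v w) hρX hρD (fun i => (V i : Set F)) (fun i j hij => ?_)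
      (fun i => ⟨0, (V i).zero_mem⟩) (M.restrictScalars ℂ)
      ((⨆ i, genFun B hnd (V i : Set F) (V i : Set F)).restrictScalars ℂ)
      (fun v => mulOp_mem M _) (derivOp_mem M) (fun v => mulOp_mem _ _) (derivOp_mem _)
      (fun f hf => ?_) (fun f hf => ?_) fun i f _ h1 h2 => ?_
    -- Distinct subspaces of equal dimension are not nested. A vector of `V j` outside `V i` is not
    -- orthogonal to `V i`, since `V i` is its own orthogonal complement; this gives the pairing
    -- that separates `i` from `j`.
    · have hne : ¬ V j ≤ V i := fun hle =>
        hij (hV (Submodule.eq_of_le_of_finrank_eq hle (by rw [hVdim, hVdim])).symm)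
      obtain ⟨v, hv, hvi⟩ := SetLike.not_le_iff_exists.1 hne
      by_contra! hcon
      refine hvi (mem_of_forall_form_eq_zero hsymm hnd hdim (hiso i) (hVdim i) fun w hw => ?_)
      by_contra hvw
      have h1 := hcon v hv w hw (by exact_mod_cast hvw)
      rw [← hsymm.eq] at hvw
      exact hvw (by exact_mod_cast h1)
    · exact (exists_prod_apply_eq_zero_of_mem_genFun B hnd hρX hρD V hiso f (hM ▸ hf)).1
    · exact (exists_prod_apply_eq_zero_of_mem_genFun B hnd hρX hρD V hiso f (hM ▸ hf)).2
    · exact le_iSup (fun i => genFun B hnd (V i : Set F) (V i : Set F)) i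
        ((mem_genFun_lagrangian_iff hsymm hnd hdim (hiso i) (hVdim i) f).2 ⟨h1, h2⟩)
  · rw [hM]
    exact genFun_mono B hnd (Set.subset_iUnion (fun i => (V i : Set F)) i)
      (Set.subset_iUnion (fun i => (V i : Set F)) i)
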